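/- Let $d\in\mathbb N$ and let $p\in(0,1)^d$ satisfy $\sum_{i=1}^d p_i<1$. Put $q=1-\sum_{i=1}^d p_i$, $\Sigma=\mathrm{diag}(p)-pp^\top$, and $$\phi_\Sigma(y)=\frac{1}{\sqrt{(2\pi)^d p_1\cdots p_d\,q}}\exp\!\Big(-\tfrac12 y^\top\Sigma^{-1}y\Big),\qquad y\in\mathbb R^d.$$ For $N\in\mathbb N$ and $k\in\mathbb N_0^d$ with $\|k\|_1=\sum_i k_i\le N$ let $$p_N(k)=\frac{N!}{(N-\|k\|_1)!\prod_i k_i!}\,q^{N-\|k\|_1}\prod_i p_i^{k_i}$$ be the multinomial probability mass function. Write $\delta_{i,b}=(b-Np_i)/\sqrt N$ for $b\in\mathbb R$, $\delta_k=(\delta_{1,k_1},\dots,\delta_{d,k_d})^\top$, $\mathcal H_k=\prod_{i=1}^d[\delta_{i,k_i-1/2},\delta_{i,k_i+1/2}]$ and, for $A\subseteq\mathbb N_0^d$, $\mathcal H_A=\bigcup_{k\in A,\ \|k\|_1\le N}\mathcal H_k$. Let $a_i=\frac1{p_i}-\frac1q$, $b_{ij\ell}=\frac{1}{p_i^2}\mathbf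 1_{\{i=j=\ell\}}-\frac1{q^2}$, $c_{ij\ell m}=\frac1{p_i^3}\mathbf 1_{\{i=j=\ell=m\}}+\frac1{q^3}$ and $e_{ij}=\frac{3}{p_i^2}\mathbf 1_{\{i=j\}}+\frac{2}{p_ip_j}\mathbf 1_{\{i<j\}}-\frac{2}{p_iq}+\frac{3}{q^2}$; all sums below are over indices from $1$ to $d$ unless stated otherwise. (1) As $N\to\infty$, uniformly over all sets $A\subseteq\mathbb N_0^d$, $$\sum_{k\in A,\ \|k\|_1\le N}p_N(k)=\int_{\mathcal H_A}\phi_\Sigma(y)\,dy+N^{-1/2}\,T_1+N^{-1}\,T_2+O_{d,p}(N^{-3/2}),$$ where $$T_1=-\tfrac12\sum_i a_i\int_{\mathcal H_A}y_i\,\phi_\Sigma(y)\,dy+\tfrac16\sum_{i,j,\ell}b_{ij\ell}\int_{\mathcal H_A}y_iy_jy_\ell\,\phi_\Sigma(y)\,dy$$ and $$\begin{aligned}T_2={}&-\tfrac1{24}\sum_i\ \sum_{k\in A,\ \|k\|_1\le N}\int_{\mathcal H_k}\big\{([\Sigma^{-1}\delta_k]_i)^2-[\Sigma^{-1}]_{ii}\big\}\phi_\Sigma(y)\,dy\\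 &-\tfrac1{12}\sum_{i,j,\ell,m}b_{ij\ell}\,a_m\int_{\mathcal H_A}y_iy_jy_\ell y_m\,\phi_\Sigma(y)\,dy-\tfrac1{12}\sum_{i,j,\ell,m}c_{ij\ell m}\int_{\mathcal H_A}y_iy_jy_\ell y_m\,\phi_\Sigma(y)\,dy\\ &+\tfrac1{72}\sum_{i,j,\ell,i',j',\ell'}b_{ij\ell}\,b_{i'j'\ell'}\int_{\mathcal H_A}y_iy_jy_\ell y_{i'}y_{j'}y_{\ell'}\,\phi_\Sigma(y)\,dy\\ &+\tfrac18\sum_{i,j}e_{ij}\int_{\mathcal H_A}y_iy_j\,\phi_\Sigma(y)\,dy+\tfrac1{12}\Big\{1-\sum_i p_i^{-1}-q^{-1}\Big\}\int_{\mathcal H_A}\phi_\Sigma(y)\,dy.\end{aligned}$$ The constant and the threshold implicit in $O_{d,p}$ depend only on $d$ and $p$. (2) For every $K\in\mathbb R$ there are $C$ and $N_0$, depending only on $d$, $p$ and $K$, such that for all $N\ge N_0$ and every Lebesgue measurable $\widetilde A\subseteq\mathbb R^d$ with $$\int_{\frac{\widetilde A-Np}{\sqrt N}\,\triangle\,\mathcal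 H_{\widetilde A\cap\mathbb N_0^d}}\phi_\Sigma(y)\,dy\le K N^{-1/2}$$ (where $\triangle$ is the symmetric difference) one has $$\Big|\sum_{k\in\widetilde A\cap\mathbb N_0^d,\ \|k\|_1\le N}p_N(k)-\int_{\frac{\widetilde A-Np}{\sqrt N}}\phi_\Sigma(y)\,dy\Big|\le C N^{-1/2}.$$ In particular, if for a fixed measurable $\widetilde A$ the integral over the symmetric difference is $O(N^{-1/2})$, then the sum equals the Gaussian integral up to $O(N^{-1/2})$. -/

import Mathlib

open MeasureTheory Filter
open scoped BigOperators Matrix Nat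

noncomputable section

namespace MultinomialLLT

variable {d : ℕ}

/-- The remaining weight `q = 1 - ‖p‖₁` (for nonnegative weights `p`). -/
def qWeight (p : Fin d → ℝ) : ℝ := 1 - ∑ i, p i

/-- The `Multinomial(N, p)` mass function at a point `k` with `‖k‖₁ ≤ N`; it is `0` elsewhere. -/
def multinomialPMF (N : ℕ) (p : Fin d → ℝ) (k : Fin d → ℕ) : ℝ :=
  if ∑ i, k i ≤ N then
    ((N ! : ℝ) / (((N - ∑ i, k i)! : ℝ) * ∏ i, ((k i)! : ℝ))) *
      qWeight p ^ (N - ∑ i, k i) * ∏ i, p i ^ k i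
  else 0

/-- The matrix `diag(p) - p pᵀ`. -/
def covMatrix (p : Fin d → ℝ) : Matrix (Fin d) (Fin d) ℝ :=
  Matrix.diagonal p - Matrix.vecMulVec p p

/-- The centred Gaussian density with covariance matrix `diag(p) - p pᵀ`,
whose determinant is `p₁ ⋯ p_d q`. -/
def gaussDensity (p : Fin d → ℝ) (y : Fin d → ℝ) : ℝ :=
  1 / √((2 * Real.pi) ^ d * (∏ i, p i) * qWeight p) *
    Real.exp (-(1 / 2) * (y ⬝ᵥ ((covMatrix p)⁻¹ *ᵥ y)))

/-- The normalization `x ↦ (x - N p) / √N`, coordinatewise. -/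
def delta (N : ℕ) (p x : Fin d → ℝ) : Fin d → ℝ :=
  fun i => (x i - N * p i) / √(N : ℝ)

/-- A lattice point seen in `ℝ^d`. -/
def toReal (k : Fin d → ℕ) : Fin d → ℝ := fun i => (k i : ℝ)

open Classical in
/-- The finite set of the points `k ∈ A` with `‖k‖₁ ≤ N`. -/
def latticePoints (N : ℕ) (A : Set (Fin d → ℕ)) : Finset (Fin d → ℕ) :=
  (Fintype.piFinset fun _ : Fin d => Finset.range (N + 1)).filter
    fun k => k ∈ A ∧ ∑ i, k i ≤ N

theorem mem_latticePoints {N : ℕ} {A : Set (Fin d → ℕ)} {k : Fin d → ℕ} :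
    k ∈ latticePoints N A ↔ k ∈ A ∧ ∑ i, k i ≤ N := by
  classical
  unfold latticePoints
  rw [Finset.mem_filter, and_iff_right_iff_imp, Fintype.mem_piFinset]
  rintro ⟨-, h⟩ i
  have := Finset.single_le_sum (f := k) (fun j _ => Nat.zero_le _) (Finset.mem_univ i)
  exact Finset.mem_range.2 (by omega)

/-- The normalized unit hypercube `∏ᵢ [δ_{i, kᵢ - 1/2}, δ_{i, kᵢ + 1/2}]`. -/
def cube (N : ℕ) (p : Fin d → ℝ) (k : Fin d → ℕ) : Set (Fin d → ℝ) :=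
  Set.univ.pi fun i =>
    Set.Icc (delta N p (fun j => (k j : ℝ) - 1 / 2) i)
      (delta N p (fun j => (k j : ℝ) + 1 / 2) i)

/-- The union of the normalized unit hypercubes around the points `k ∈ A` with `‖k‖₁ ≤ N`. -/
def cubeUnion (N : ℕ) (p : Fin d → ℝ) (A : Set (Fin d → ℕ)) : Set (Fin d → ℝ) :=
  ⋃ k ∈ latticePoints N A, cube N p k

/-- `1/pᵢ - 1/q`. -/
def linCoef (p : Fin d → ℝ) (i : Fin d) : ℝ := 1 / p i - 1 / qWeight p

/-- `1_{i=j=l}/pᵢ² - 1/q²`. -/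
def cubCoef (p : Fin d → ℝ) (i j l : Fin d) : ℝ :=
  (if i = j ∧ j = l then 1 / p i ^ 2 else 0) - 1 / qWeight p ^ 2

/-- `1_{i=j=l=m}/pᵢ³ + 1/q³`. -/
def quartCoef (p : Fin d → ℝ) (i j l m : Fin d) : ℝ :=
  (if i = j ∧ j = l ∧ l = m then 1 / p i ^ 3 else 0) + 1 / qWeight p ^ 3

/-- `3·1_{i=j}/pᵢ² + 2·1_{i<j}/(pᵢ pⱼ) - 2/(pᵢ q) + 3/q²`. -/
def quadCoef (p : Fin d → ℝ) (i j : Fin d) : ℝ :=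
  (if i = j then 3 / p i ^ 2 else 0) + (if i < j then 2 / (p i * p j) else 0)
    - 2 / (p i * qWeight p) + 3 / qWeight p ^ 2

/-- The coefficient of `N^{-1/2}` in the expansion. -/
def firstCorrection (N : ℕ) (p : Fin d → ℝ) (A : Set (Fin d → ℕ)) : ℝ :=
  -(1 / 2) * (∑ i, linCoef p i * (∫ y in cubeUnion N p A, y i * gaussDensity p y))
  + 1 / 6 * (∑ i, ∑ j, ∑ l, cubCoef p i j l *
      (∫ y in cubeUnion N p A, y i * y j * y l * gaussDensity p y))

/-- The coefficient of `N^{-1}` in the expansion. In its first term the integrand is, on each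
of the (almost disjoint) cubes, built from the centre `δ_k` of that cube. -/
def secondCorrection (N : ℕ) (p : Fin d → ℝ) (A : Set (Fin d → ℕ)) : ℝ :=
  -(1 / 24) * (∑ i, ∑ k ∈ latticePoints N A, (∫ y in cube N p k,
      ((((covMatrix p)⁻¹ *ᵥ delta N p (toReal k)) i) ^ 2 - (covMatrix p)⁻¹ i i) *
        gaussDensity p y))
  - 1 / 12 * (∑ i, ∑ j, ∑ l, ∑ m, cubCoef p i j l * linCoef p m *
      (∫ y in cubeUnion N p A, y i * y j * y l * y m * gaussDensity p y))
  - 1 / 12 * (∑ i, ∑ j, ∑ l, ∑ m, quartCoef p i j l m *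
      (∫ y in cubeUnion N p A, y i * y j * y l * y m * gaussDensity p y))
  + 1 / 72 * (∑ i, ∑ j, ∑ l, ∑ i', ∑ j', ∑ l', cubCoef p i j l * cubCoef p i' j' l' *
      (∫ y in cubeUnion N p A, y i * y j * y l * y i' * y j' * y l' * gaussDensity p y))
  + 1 / 8 * (∑ i, ∑ j, quadCoef p i j *
      (∫ y in cubeUnion N p A, y i * y j * gaussDensity p y))
  + 1 / 12 * (1 - (∑ i, (p i)⁻¹) - (qWeight p)⁻¹) *
      (∫ y in cubeUnion N p A, gaussDensity p y)

end MultinomialLLT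

end

/-!
The mass function is compared with the Gaussian integrals cube by cube, with errors that are summed
in absolute value over the whole lattice; uniformity in `A` is then automatic. Throughout,
`s = N^{-1/2}` is the side of the cubes, `x` the normalized lattice point `δ_k`, and a function of
`(s, x, …)` is of order `sⁿ` (`Scale.IsO`) if it is bounded by `C sⁿ exp (C ‖x‖₁)` for some `C`.
Exponential factors are harmless, since the Gaussian density absorbs them
(`gaussDensity_mul_exp_le`), and these orders are stable under all algebraic operations and under
Taylor expansion of the exponential. All `d + 1` cells are treated alike by indexing them with
`Option (Fin d)`, the value at `none` being determined by the others; in these coordinates the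
inverse covariance is diagonal and the correction terms are sums over single cells.

Three estimates carry the proof.

* Local expansion. When all relative deviations of the cell counts are at most `1/2` and
  `s ‖x‖₁³ ≤ 1`, Stirling's formula with the `1/(12 n)` term and the Taylor expansion of
  `(1 + t) log (1 + t)` give `p_N(k) = s^d φ(x) (1 + s P₁(x) + s² P₂(x) + O(s³))`, with explicit
  polynomials `corrOne` and `corrTwo` (`isO_exp_logRatio_sub`).
* Midpoint rule. For every `x`, the integral of `(1 + s P₁ + s² P₂) φ` over the cube centred at `x`
  differs from `s^d` times the value at `x` by `(s² / 24) Δφ(x) s^d` up to `O(s³)`; the Laplacian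
  term is the first sum in the second correction (`exists_midpoint_bound`).
* Tails. Outside the range of the local expansion `1 ≤ M s³ exp ‖x‖₁`, so that the contribution
  there is `O(s³)` because `exp ‖x‖₁` has bounded expectation under the multinomial distribution
  (`sum_multinomialPMF_mul_exp_l1Norm_le`, by a Chernoff bound) and under the Riemann sums of the
  Gaussian density (`exists_sum_gaussDensity_mul_exp_le`).

The second assertion follows from the first: the two correction terms are bounded, and replacing
one domain of integration by another costs at most the Gaussian measure of the symmetric difference.
-/

open scoped Pointwise

noncomputable section

namespace MultinomialLLT

/-! ### Orders in a small scale, up to exponential growth -/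

/-- A parameter space `Ω` carrying a small scale `s ∈ (0, 1]` and a nonnegative size. -/
structure Scale (Ω : Type*) where
  s : Ω → ℝ
  size : Ω → ℝ
  s_pos : ∀ ω, 0 < s ω
  s_le_one : ∀ ω, s ω ≤ 1
  size_nonneg : ∀ ω, 0 ≤ size ω

namespace Scale

variable {Ω : Type*} {σ : Scale Ω} {n m : ℕ} {f g : Ω → ℝ}

/-- `σ.IsO n f` says that `f` is of order `s ^ n`, up to a factor that grows at most exponentially
in the size: the constant `C` serves both as prefactor and as growth rate. -/
def IsO (σ : Scale Ω) (n : ℕ) (f : Ω → ℝ) : Prop :=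
  ∃ C : ℝ, 0 ≤ C ∧ ∀ ω, |f ω| ≤ C * σ.s ω ^ n * Real.exp (C * σ.size ω)

theorem IsO.of_bound {C c : ℝ} (h : ∀ ω, |f ω| ≤ C * σ.s ω ^ n * Real.exp (c * σ.size ω)) :
    σ.IsO n f := by
  refine ⟨max (max C c) 0, le_max_right _ _, fun ω => (h ω).trans ?_⟩
  have hs := (σ.s_pos ω).le
  have hl := σ.size_nonneg ω
  have h1 : C ≤ max (max C c) 0 := (le_max_left _ _).trans (le_max_left _ _)
  have h2 : c ≤ max (max C c) 0 := (le_max_right _ _).trans (le_max_left _ _)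
  have h3 : (0 : ℝ) ≤ max (max C c) 0 := le_max_right _ _
  gcongr

theorem IsO.mono (h : σ.IsO n f) (hmn : m ≤ n) : σ.IsO m f := by
  obtain ⟨C, hC, hf⟩ := h
  refine ⟨C, hC, fun ω => (hf ω).trans ?_⟩
  have := pow_le_pow_of_le_one (σ.s_pos ω).le (σ.s_le_one ω) hmn
  gcongr

theorem IsO.of_abs_le (h : σ.IsO n g) (hfg : ∀ ω, |f ω| ≤ |g ω|) : σ.IsO n f := by
  obtain ⟨C, hC, hg⟩ := h
  exact ⟨C, hC, fun ω => (hfg ω).trans (hg ω)⟩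

theorem IsO.congr (hf : σ.IsO n f) (h : ∀ ω, g ω = f ω) : σ.IsO n g :=
  hf.of_abs_le fun ω => by rw [h]

theorem IsO.abs (hf : σ.IsO n f) : σ.IsO n fun ω => |f ω| :=
  hf.of_abs_le fun ω => (abs_abs (f ω)).le

theorem IsO.add (hf : σ.IsO n f) (hg : σ.IsO n g) : σ.IsO n fun ω => f ω + g ω := by
  obtain ⟨C, hC, hf⟩ := hf
  obtain ⟨C', hC', hg⟩ := hg
  refine ⟨C + C', by positivity, fun ω => (abs_add_le _ _).trans ?_⟩
  have hs := (σ.s_pos ω).le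
  have hl := σ.size_nonneg ω
  calc |f ω| + |g ω|
      ≤ C * σ.s ω ^ n * Real.exp (C * σ.size ω) + C' * σ.s ω ^ n * Real.exp (C' * σ.size ω) :=
        add_le_add (hf ω) (hg ω)
    _ ≤ C * σ.s ω ^ n * Real.exp ((C + C') * σ.size ω)
        + C' * σ.s ω ^ n * Real.exp ((C + C') * σ.size ω) := by
        gcongr <;> linarith
    _ = _ := by ring

theorem IsO.mul (hf : σ.IsO n f) (hg : σ.IsO m g) : σ.IsO (n + m) fun ω => f ω * g ω := by
  obtain ⟨C, hC, hf⟩ := hf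
  obtain ⟨C', hC', hg⟩ := hg
  refine IsO.of_bound (C := C * C') (c := C + C') fun ω => ?_
  have hs := (σ.s_pos ω).le
  rw [abs_mul]
  calc |f ω| * |g ω|
      ≤ (C * σ.s ω ^ n * Real.exp (C * σ.size ω)) *
          (C' * σ.s ω ^ m * Real.exp (C' * σ.size ω)) := by
        gcongr
        · exact hf ω
        · exact hg ω
    _ = _ := by rw [add_mul C, Real.exp_add, pow_add]; ring

theorem IsO.const_mul (c : ℝ) (hf : σ.IsO n f) : σ.IsO n fun ω => c * f ω := by
  obtain ⟨C, hC, hf⟩ := hf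
  refine IsO.of_bound (C := |c| * C) (c := C) fun ω => ?_
  rw [abs_mul, mul_assoc |c|, mul_assoc |c|]
  exact mul_le_mul_of_nonneg_left (hf ω) (abs_nonneg c)

theorem IsO.mul_const (hf : σ.IsO n f) (c : ℝ) : σ.IsO n fun ω => f ω * c := by
  simpa only [mul_comm c] using hf.const_mul c

theorem IsO.div_const (hf : σ.IsO n f) (c : ℝ) : σ.IsO n fun ω => f ω / c := by
  simpa only [div_eq_mul_inv] using hf.mul_const c⁻¹

theorem IsO.neg (hf : σ.IsO n f) : σ.IsO n fun ω => -f ω :=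
  hf.of_abs_le fun ω => (abs_neg (f ω)).le

theorem IsO.sub (hf : σ.IsO n f) (hg : σ.IsO n g) : σ.IsO n fun ω => f ω - g ω := by
  simpa only [sub_eq_add_neg] using hf.add hg.neg

theorem isO_of_bounded {C : ℝ} (h : ∀ ω, |f ω| ≤ C) : σ.IsO 0 f :=
  IsO.of_bound (C := C) (c := 0) fun ω => by simpa using h ω

theorem isO_const (c : ℝ) : σ.IsO 0 fun _ => c := isO_of_bounded fun _ => le_rfl

theorem IsO.of_mul_pow_s (hf : σ.IsO n f) (m : ℕ) : σ.IsO (n + m) fun ω => f ω * σ.s ω ^ m := by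
  refine hf.mul ⟨1, zero_le_one, fun ω => ?_⟩
  have hs := (σ.s_pos ω).le
  rw [abs_of_nonneg (by positivity), one_mul]
  exact le_mul_of_one_le_right (by positivity)
    (Real.one_le_exp (mul_nonneg zero_le_one (σ.size_nonneg ω)))

theorem isO_s : σ.IsO 1 σ.s := by
  simpa using (isO_const (σ := σ) 1).of_mul_pow_s 1

theorem isO_of_abs_le_size {c : ℝ} (h : ∀ ω, |f ω| ≤ c * (1 + σ.size ω)) : σ.IsO 0 f := by
  refine IsO.of_bound (C := |c|) (c := 1) fun ω => (h ω).trans ?_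
  have hl := σ.size_nonneg ω
  rw [pow_zero, mul_one]
  have h1 := Real.add_one_le_exp (1 * σ.size ω)
  calc c * (1 + σ.size ω) ≤ |c| * (1 + σ.size ω) := by gcongr; exact le_abs_self c
    _ ≤ _ := by gcongr; linarith

theorem IsO.pow (hf : σ.IsO n f) (r : ℕ) : σ.IsO (n * r) fun ω => f ω ^ r := by
  induction r with
  | zero => simpa using isO_const (σ := σ) 1
  | succ r ih => simpa only [pow_succ, Nat.mul_succ] using ih.mul hf

theorem IsO.sum {ι : Type*} (t : Finset ι) {F : ι → Ω → ℝ} (h : ∀ i ∈ t, σ.IsO n (F i)) :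
    σ.IsO n fun ω => ∑ i ∈ t, F i ω := by
  classical
  induction t using Finset.induction_on with
  | empty => simpa using ((isO_const (σ := σ) 0).of_mul_pow_s n)
  | insert a t ha ih =>
    simp only [Finset.sum_insert ha]
    exact (h a (Finset.mem_insert_self a t)).add
      (ih fun i hi => h i (Finset.mem_insert_of_mem hi))

/-- The second-order Taylor remainder of the exponential, with a bound valid on all of `ℝ`. -/
theorem abs_exp_sub_taylor_le (w : ℝ) :
    |Real.exp w - (1 + w + w ^ 2 / 2)| ≤ |w| ^ 3 * Real.exp |w| := by
  have h := Complex.norm_exp_sub_sum_le_norm_mul_exp (w : ℂ) 3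
  rw [Complex.norm_real, Real.norm_eq_abs] at h
  convert h using 1
  rw [← Real.norm_eq_abs, ← Complex.norm_real]
  congr 1
  simp [Finset.sum_range_succ]

/-- If the exponent `w` is `O(s)` and grows at most linearly in the size, then `exp w` agrees
with its second-order Taylor polynomial up to `O(s³)`. -/
theorem IsO.exp_taylor {w : Ω → ℝ} (hw : σ.IsO 1 w) {c : ℝ}
    (hlin : ∀ ω, |w ω| ≤ c * (1 + σ.size ω)) :
    σ.IsO 3 fun ω => Real.exp (w ω) - (1 + w ω + w ω ^ 2 / 2) := by
  have hE : σ.IsO 0 fun ω => Real.exp |w ω| := by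
    refine IsO.of_bound (C := Real.exp c) (c := c) fun ω => ?_
    rw [abs_of_pos (Real.exp_pos _), pow_zero, mul_one, ← Real.exp_add]
    exact Real.exp_le_exp.2 ((hlin ω).trans_eq (by ring))
  refine ((hw.pow 3).mul hE).of_abs_le fun ω => ?_
  refine (abs_exp_sub_taylor_le _).trans_eq ?_
  rw [abs_mul, abs_pow, abs_of_pos (Real.exp_pos _)]

end Scale

/-! ### Stirling's formula and logarithmic expansions -/

open Stirling in
theorem tendsto_log_stirlingSeq :
    Tendsto (fun n : ℕ => Real.log (stirlingSeq (n + 1)) - Real.log (√Real.pi)) atTop (nhds 0) := by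
  have h := (tendsto_stirlingSeq_sqrt_pi.log (by positivity)).comp (tendsto_add_atTop_nat 1)
  simpa using h.sub_const (Real.log (√Real.pi))

theorem tendsto_one_div_twelve_mul_add (c : ℝ) :
    Tendsto (fun n : ℕ => 1 / (12 * ((n : ℝ) + 1) + c)) atTop (nhds 0) := by
  have h1 : Tendsto (fun n : ℕ => 12 * ((n : ℝ) + 1) + c) atTop atTop :=
    tendsto_atTop_add_const_right _ _ (Tendsto.const_mul_atTop (by norm_num)
      (tendsto_atTop_add_const_right _ _ tendsto_natCast_atTop_atTop))
  simp only [one_div]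
  exact h1.inv_tendsto_atTop

open Stirling in
/-- The first term of the series of `log (stirlingSeq (n + 1)) - log (stirlingSeq (n + 2))` already
dominates an increment of `1 / (12 n + 1)`. -/
theorem le_log_stirlingSeq_sub (n : ℕ) :
    1 / (12 * ((n : ℝ) + 1) + 1) - 1 / (12 * (((n + 1 : ℕ) : ℝ) + 1) + 1) ≤
      Real.log (stirlingSeq (n + 1)) - Real.log (stirlingSeq (n + 2)) := by
  have h := (log_stirlingSeq_sdiff_hasSum n)
  have h0 := h.summable.le_tsum 0 (fun j _ => by positivity)
  rw [h.tsum_eq] at h0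
  refine le_trans ?_ h0
  push_cast
  have hn : (0 : ℝ) ≤ n := n.cast_nonneg
  rw [div_sub_div _ _ (by positivity) (by positivity), div_pow, pow_one,
    div_mul_div_comm, div_le_div_iff₀ (by positivity) (by positivity)]
  nlinarith

/-- The error of Stirling's formula with the `1 / (12 n)` term. -/
def stirlingError (n : ℕ) : ℝ :=
  Real.log (n ! : ℝ) - (Real.log (2 * Real.pi * n) / 2 + n * Real.log n - n) - 1 / (12 * n)

open Stirling in
/-- Stirling's formula with the `1 / (12 n)` term and a remainder of order `n⁻²`. -/
theorem abs_stirlingError_le {n : ℕ} (hn : n ≠ 0) : |stirlingError n| ≤ 1 / (n : ℝ) ^ 2 := by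
  obtain ⟨m, rfl⟩ := Nat.exists_eq_succ_of_ne_zero hn
  -- the logarithm of `stirlingSeq n / √π` tends to `0`, and its increments lie between those of
  -- `1 / (12 n + 1)` and `1 / (12 n)`
  have hupper : Real.log (stirlingSeq (m + 1)) - Real.log (√Real.pi)
      - 1 / (12 * ((m : ℝ) + 1) + 0) ≤ 0 := by
    have hmono : Monotone fun m : ℕ => Real.log (stirlingSeq (m + 1)) - Real.log (√Real.pi)
        - 1 / (12 * ((m : ℝ) + 1) + 0) := by
      refine monotone_nat_of_le_succ fun k => ?_
      have h := log_stirlingSeq_sdiff_le (k + 1)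
      have hk : (0 : ℝ) ≤ k := k.cast_nonneg
      have e : 1 / (12 * ((k + 1 : ℕ) : ℝ) * (((k + 1 : ℕ) : ℝ) + 1)) =
          1 / (12 * ((k : ℝ) + 1) + 0) - 1 / (12 * (((k + 1 : ℕ) : ℝ) + 1) + 0) := by
        push_cast
        field_simp
        ring
      rw [e] at h
      linarith
    refine hmono.ge_of_tendsto (a := 0) ?_ m
    simpa using tendsto_log_stirlingSeq.sub (tendsto_one_div_twelve_mul_add 0)
  have hlower : 0 ≤ Real.log (stirlingSeq (m + 1)) - Real.log (√Real.pi)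
      - 1 / (12 * ((m : ℝ) + 1) + 1) := by
    have hanti : Antitone fun m : ℕ => Real.log (stirlingSeq (m + 1)) - Real.log (√Real.pi)
        - 1 / (12 * ((m : ℝ) + 1) + 1) := by
      refine antitone_nat_of_succ_le fun k => ?_
      have h := le_log_stirlingSeq_sub k
      linarith
    refine hanti.le_of_tendsto (a := 0) ?_ m
    simpa using tendsto_log_stirlingSeq.sub (tendsto_one_div_twelve_mul_add 1)
  have hm : (0 : ℝ) < (m : ℝ) + 1 := by positivity
  have hgap : 1 / (12 * ((m : ℝ) + 1)) - 1 / ((m : ℝ) + 1) ^ 2 ≤ 1 / (12 * ((m : ℝ) + 1) + 1) := by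
    rw [div_sub_div _ _ (by positivity) (by positivity),
      div_le_div_iff₀ (by positivity) (by positivity)]
    nlinarith [pow_pos hm 2, pow_pos hm 3]
  rw [log_stirlingSeq_formula, Real.log_sqrt Real.pi_pos.le,
    Real.log_div (by positivity) (by positivity), Real.log_exp] at hupper hlower
  have hlog : Real.log (2 * Real.pi * ((m + 1 : ℕ) : ℝ)) =
      Real.log (2 * ((m + 1 : ℕ) : ℝ)) + Real.log Real.pi := by
    rw [← Real.log_mul (by positivity) (by positivity)]
    ring_nf
  rw [stirlingError, Nat.succ_eq_add_one, hlog, abs_le]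
  push_cast at *
  have hpos : 0 ≤ 1 / ((m : ℝ) + 1) ^ 2 := by positivity
  rw [add_zero] at hupper
  constructor <;> linarith

/-- The Taylor polynomials of `log (1 + t)` around `0`, with the remainder bound on
`[-1/2, 1/2]`. -/
theorem abs_log_one_add_sub_le {t : ℝ} (ht : |t| ≤ 1 / 2) (n : ℕ) :
    |Real.log (1 + t) + ∑ i ∈ Finset.range n, (-t) ^ (i + 1) / (i + 1)| ≤ 2 * |t| ^ (n + 1) := by
  have h := Real.abs_log_sub_add_sum_range_le (x := -t) (by rw [abs_neg]; linarith) n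
  rw [sub_neg_eq_add, abs_neg, add_comm] at h
  refine h.trans ?_
  rw [div_le_iff₀ (by linarith)]
  nlinarith [pow_nonneg (abs_nonneg t) (n + 1)]

theorem abs_log_one_add_le {t : ℝ} (ht : |t| ≤ 1 / 2) : |Real.log (1 + t)| ≤ 2 * |t| := by
  simpa using abs_log_one_add_sub_le ht 0

theorem abs_log_one_add_sub_two_le {t : ℝ} (ht : |t| ≤ 1 / 2) :
    |Real.log (1 + t) - (t - t ^ 2 / 2)| ≤ 2 * |t| ^ 3 := by
  have h := abs_log_one_add_sub_le ht 2
  simp only [Finset.sum_range_succ, Finset.sum_range_zero] at h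
  convert h using 2
  push_cast
  ring

/-- The expansion of the entropy function `(1 + t) log (1 + t)` to fourth order. -/
theorem abs_entropy_sub_le {t : ℝ} (ht : |t| ≤ 1 / 2) :
    |(1 + t) * Real.log (1 + t) - (t + t ^ 2 / 2 - t ^ 3 / 6 + t ^ 4 / 12)| ≤ 4 * |t| ^ 5 := by
  have h := abs_log_one_add_sub_le ht 4
  simp only [Finset.sum_range_succ, Finset.sum_range_zero] at h
  set r := Real.log (1 + t) + (0 + (-t) ^ (0 + 1) / (((0 : ℕ) : ℝ) + 1)
    + (-t) ^ (1 + 1) / (((1 : ℕ) : ℝ) + 1) + (-t) ^ (2 + 1) / (((2 : ℕ) : ℝ) + 1)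
    + (-t) ^ (3 + 1) / (((3 : ℕ) : ℝ) + 1)) with hr
  have e : (1 + t) * Real.log (1 + t) - (t + t ^ 2 / 2 - t ^ 3 / 6 + t ^ 4 / 12)
      = (1 + t) * r - t ^ 5 / 4 := by
    rw [hr]; push_cast; ring
  have h1 : |1 + t| ≤ 3 / 2 := by
    rw [abs_le] at ht ⊢; constructor <;> linarith
  rw [e]
  calc |(1 + t) * r - t ^ 5 / 4| ≤ |1 + t| * |r| + |t| ^ 5 / 4 := by
        refine (abs_sub _ _).trans_eq ?_
        rw [abs_mul, abs_div, abs_pow, abs_of_pos (by norm_num : (0 : ℝ) < 4)]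
    _ ≤ 3 / 2 * (2 * |t| ^ 5) + |t| ^ 5 / 4 := by gcongr
    _ ≤ 4 * |t| ^ 5 := by nlinarith [pow_nonneg (abs_nonneg t) 5]

theorem abs_entropy_sub_two_le {t : ℝ} (ht : |t| ≤ 1 / 2) :
    |(1 + t) * Real.log (1 + t) - (t + t ^ 2 / 2)| ≤ 2 * |t| ^ 3 := by
  have h := abs_entropy_sub_le ht
  have e : (1 + t) * Real.log (1 + t) - (t + t ^ 2 / 2) =
      ((1 + t) * Real.log (1 + t) - (t + t ^ 2 / 2 - t ^ 3 / 6 + t ^ 4 / 12))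
        + (- (t ^ 3 / 6) + t ^ 4 / 12) := by ring
  have h3 : |t| ^ 4 ≤ |t| ^ 3 * (1 / 2) := by rw [pow_succ |t| 3]; gcongr
  have h5 : |t| ^ 5 ≤ |t| ^ 3 * (1 / 2) ^ 2 := by
    rw [show 5 = 3 + 2 by rfl, pow_add]; gcongr
  have h6 : |- (t ^ 3 / 6) + t ^ 4 / 12| ≤ |t| ^ 3 / 6 + |t| ^ 4 / 12 := by
    refine (abs_add_le _ _).trans_eq ?_
    rw [abs_neg, abs_div, abs_div, abs_pow, abs_pow, abs_of_pos (by norm_num : (0 : ℝ) < 6),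
      abs_of_pos (by norm_num : (0 : ℝ) < 12)]
  rw [e]
  refine (abs_add_le _ _).trans ?_
  have := pow_nonneg (abs_nonneg t) 3
  linarith

theorem abs_inv_one_add_sub_one_le {t : ℝ} (ht : |t| ≤ 1 / 2) : |(1 + t)⁻¹ - 1| ≤ 2 * |t| := by
  have h1 : 1 / 2 ≤ 1 + t := by rw [abs_le] at ht; linarith
  have e : (1 + t)⁻¹ - 1 = -t / (1 + t) := by field_simp; ring
  rw [e, abs_div, abs_neg, abs_of_pos (by linarith : 0 < 1 + t), div_le_iff₀ (by linarith)]
  nlinarith [abs_nonneg t]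

/-! ### The Gaussian density and the correction polynomials -/

variable {d : ℕ}

/-- The weights of all `d + 1` cells: `pᵢ` at `some i`, and `q` at `none`. -/
def fullWeight (p : Fin d → ℝ) : Option (Fin d) → ℝ := fun o => o.elim (qWeight p) p

/-- The extension of `x` by the coordinate `-∑ xᵢ` at `none`, so that all coordinates sum to `0`. -/
def fullCoord (x : Fin d → ℝ) : Option (Fin d) → ℝ := fun o => o.elim (-∑ i, x i) x

/-- The norm `∑ |xᵢ|`. -/
def l1Norm (x : Fin d → ℝ) : ℝ := ∑ i, |x i|

/-- The bilinear form of `(diag(p) - p pᵀ)⁻¹`, which is diagonal in the coordinates `fullCoord`. -/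
def covForm (p x y : Fin d → ℝ) : ℝ := ∑ o, fullCoord x o * fullCoord y o / fullWeight p o

@[simp] theorem fullWeight_none (p : Fin d → ℝ) : fullWeight p none = qWeight p := rfl

@[simp] theorem fullWeight_some (p : Fin d → ℝ) (i : Fin d) : fullWeight p (some i) = p i := rfl

@[simp] theorem fullCoord_none (x : Fin d → ℝ) : fullCoord x none = -∑ i, x i := rfl

@[simp] theorem fullCoord_some (x : Fin d → ℝ) (i : Fin d) : fullCoord x (some i) = x i := rfl

theorem sum_fullCoord (x : Fin d → ℝ) : ∑ o, fullCoord x o = 0 := by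
  simp [Fintype.sum_option]

theorem fullWeight_pos {p : Fin d → ℝ} (hp : ∀ i, p i ∈ Set.Ioo (0 : ℝ) 1) (hsum : ∑ i, p i < 1)
    (o : Option (Fin d)) : 0 < fullWeight p o := by
  cases o with
  | none => simpa [qWeight] using hsum
  | some i => exact (hp i).1

theorem fullCoord_add (x y : Fin d → ℝ) (o : Option (Fin d)) :
    fullCoord (x + y) o = fullCoord x o + fullCoord y o := by
  cases o <;> simp [Finset.sum_add_distrib]; ring

theorem fullCoord_smul (c : ℝ) (x : Fin d → ℝ) (o : Option (Fin d)) :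
    fullCoord (c • x) o = c * fullCoord x o := by
  cases o <;> simp [Finset.mul_sum]

theorem l1Norm_nonneg (x : Fin d → ℝ) : 0 ≤ l1Norm x := Finset.sum_nonneg fun _ _ => abs_nonneg _

theorem abs_fullCoord_le (x : Fin d → ℝ) (o : Option (Fin d)) : |fullCoord x o| ≤ l1Norm x := by
  cases o with
  | none => simpa [l1Norm] using Finset.abs_sum_le_sum_abs x Finset.univ
  | some i =>
    have h := Finset.single_le_sum (f := fun i => |x i|) (s := Finset.univ)
      (fun _ _ => abs_nonneg _) (Finset.mem_univ i)
    exact h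

theorem covForm_eq (p x y : Fin d → ℝ) :
    covForm p x y = ∑ i, x i * y i / p i + (∑ i, x i) * (∑ i, y i) / qWeight p := by
  simp [covForm, Fintype.sum_option]
  ring

theorem covForm_comm (p x y : Fin d → ℝ) : covForm p x y = covForm p y x := by
  simp only [covForm, mul_comm]

theorem covForm_add_left (p x y z : Fin d → ℝ) :
    covForm p (x + y) z = covForm p x z + covForm p y z := by
  simp only [covForm, fullCoord_add, add_mul, add_div, Finset.sum_add_distrib]

theorem covForm_smul_left (p : Fin d → ℝ) (c : ℝ) (x z : Fin d → ℝ) :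
    covForm p (c • x) z = c * covForm p x z := by
  simp only [covForm, fullCoord_smul, Finset.mul_sum]
  exact Finset.sum_congr rfl fun o _ => by ring

theorem covForm_add_smul_self (p : Fin d → ℝ) (s : ℝ) (x u : Fin d → ℝ) :
    covForm p (x + s • u) (x + s • u) =
      covForm p x x + 2 * s * covForm p x u + s ^ 2 * covForm p u u := by
  rw [covForm_add_left, covForm_smul_left, covForm_comm p x, covForm_comm p u,
    covForm_add_left, covForm_add_left, covForm_smul_left, covForm_smul_left, covForm_comm p u x]
  ring

theorem covMatrix_inv {p : Fin d → ℝ} (hp : ∀ i, p i ∈ Set.Ioo (0 : ℝ) 1) (hsum : ∑ i, p i < 1) :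
    (covMatrix p)⁻¹ = Matrix.diagonal (fun i => (p i)⁻¹) + Matrix.of fun _ _ => (qWeight p)⁻¹ := by
  refine Matrix.inv_eq_right_inv ?_
  have hq : qWeight p ≠ 0 := (fullWeight_pos hp hsum none).ne'
  ext i j
  have hj : p j ≠ 0 := (hp j).1.ne'
  have h1 : ∑ x, p i * p x * (qWeight p)⁻¹ = p i * (1 - qWeight p) * (qWeight p)⁻¹ := by
    rw [← Finset.sum_mul, ← Finset.mul_sum, qWeight, sub_sub_cancel]
  rw [covMatrix, sub_mul, mul_add, mul_add, Matrix.diagonal_mul_diagonal]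
  simp only [Matrix.sub_apply, Matrix.add_apply, Matrix.diagonal_mul, Matrix.mul_diagonal,
    Matrix.of_apply, Matrix.vecMulVec_apply, Matrix.mul_apply (M := Matrix.vecMulVec p p)
      (N := Matrix.of _), h1, Matrix.one_apply, Matrix.diagonal_apply]
  split_ifs with h
  · subst h
    field_simp
    ring
  · field_simp
    ring

theorem covMatrix_inv_mulVec {p : Fin d → ℝ} (hp : ∀ i, p i ∈ Set.Ioo (0 : ℝ) 1)
    (hsum : ∑ i, p i < 1) (x : Fin d → ℝ) (i : Fin d) :
    ((covMatrix p)⁻¹ *ᵥ x) i = x i / p i + (∑ j, x j) / qWeight p := by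
  rw [covMatrix_inv hp hsum, Matrix.add_mulVec, Pi.add_apply, Matrix.mulVec_diagonal]
  simp only [Matrix.mulVec, dotProduct, Matrix.of_apply, ← Finset.mul_sum]
  ring

theorem dotProduct_covMatrix_inv_mulVec {p : Fin d → ℝ} (hp : ∀ i, p i ∈ Set.Ioo (0 : ℝ) 1)
    (hsum : ∑ i, p i < 1) (x y : Fin d → ℝ) : x ⬝ᵥ ((covMatrix p)⁻¹ *ᵥ y) = covForm p x y := by
  simp only [dotProduct, covMatrix_inv_mulVec hp hsum, covForm_eq, mul_add, Finset.sum_add_distrib]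
  congr 1
  · exact Finset.sum_congr rfl fun i _ => by ring
  · rw [← Finset.sum_mul]; ring

theorem continuous_gaussDensity (p : Fin d → ℝ) : Continuous (gaussDensity p) := by
  unfold gaussDensity
  simp only [dotProduct, Matrix.mulVec]
  fun_prop

theorem gaussDensity_pos {p : Fin d → ℝ} (hp : ∀ i, p i ∈ Set.Ioo (0 : ℝ) 1)
    (hsum : ∑ i, p i < 1) (x : Fin d → ℝ) : 0 < gaussDensity p x := by
  have hq : 0 < qWeight p := fullWeight_pos hp hsum none
  have hprod : 0 < ∏ i, p i := Finset.prod_pos fun i _ => (hp i).1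
  unfold gaussDensity
  positivity

theorem gaussDensity_eq {p : Fin d → ℝ} (hp : ∀ i, p i ∈ Set.Ioo (0 : ℝ) 1)
    (hsum : ∑ i, p i < 1) (x : Fin d → ℝ) :
    gaussDensity p x = gaussDensity p 0 * Real.exp (-(1 / 2) * covForm p x x) := by
  unfold gaussDensity
  rw [dotProduct_covMatrix_inv_mulVec hp hsum]
  simp

theorem gaussDensity_add_smul {p : Fin d → ℝ} (hp : ∀ i, p i ∈ Set.Ioo (0 : ℝ) 1)
    (hsum : ∑ i, p i < 1) (s : ℝ) (x u : Fin d → ℝ) :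
    gaussDensity p (x + s • u) = gaussDensity p x *
      Real.exp (-(s * covForm p x u) - s ^ 2 * covForm p u u / 2) := by
  rw [gaussDensity_eq hp hsum, gaussDensity_eq hp hsum x, covForm_add_smul_self,
    mul_assoc (gaussDensity p 0), ← Real.exp_add]
  ring_nf

theorem sum_sq_le_covForm {p : Fin d → ℝ} (hp : ∀ i, p i ∈ Set.Ioo (0 : ℝ) 1)
    (hsum : ∑ i, p i < 1) (x : Fin d → ℝ) : ∑ i, x i ^ 2 ≤ covForm p x x := by
  have hq : 0 < qWeight p := fullWeight_pos hp hsum none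
  rw [covForm_eq]
  have h1 : ∑ i, x i ^ 2 ≤ ∑ i, x i * x i / p i := by
    refine Finset.sum_le_sum fun i _ => ?_
    rw [le_div_iff₀ (hp i).1, ← sq]
    exact mul_le_of_le_one_right (sq_nonneg _) (hp i).2.le
  have h2 : 0 ≤ (∑ i, x i) * (∑ i, x i) / qWeight p :=
    div_nonneg (mul_self_nonneg _) hq.le
  linarith

/-- The Gaussian density absorbs exponential factors of any rate. -/
theorem gaussDensity_mul_exp_le {p : Fin d → ℝ} (hp : ∀ i, p i ∈ Set.Ioo (0 : ℝ) 1)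
    (hsum : ∑ i, p i < 1) (C : ℝ) :
    ∃ C' : ℝ, 0 ≤ C' ∧ ∀ x : Fin d → ℝ,
      gaussDensity p x * Real.exp (C * l1Norm x) ≤ C' * Real.exp (-l1Norm x) := by
  have h0 := gaussDensity_pos hp hsum 0
  refine ⟨gaussDensity p 0 * Real.exp (d * ((C + 1) ^ 2 / 2)), by positivity, fun x => ?_⟩
  rw [gaussDensity_eq hp hsum, mul_assoc, mul_assoc, ← Real.exp_add, ← Real.exp_add]
  refine mul_le_mul_of_nonneg_left (Real.exp_le_exp.2 ?_) h0.le
  have h1 := sum_sq_le_covForm hp hsum x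
  have h2 : (C + 1) * l1Norm x ≤ ∑ i, (x i ^ 2 / 2 + (C + 1) ^ 2 / 2) := by
    rw [l1Norm, Finset.mul_sum]
    refine Finset.sum_le_sum fun i _ => ?_
    nlinarith [sq_nonneg (|x i| - (C + 1)), sq_abs (x i)]
  rw [Finset.sum_add_distrib, ← Finset.sum_div] at h2
  simp only [Finset.sum_const, Finset.card_univ, Fintype.card_fin, nsmul_eq_mul] at h2
  linarith

/-- The coefficient of `N^{-1/2}` in the expansion of the ratio between the mass function and the
Gaussian density, as a polynomial in the normalized point. -/
def corrOne (p x : Fin d → ℝ) : ℝ :=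
  ∑ o, (fullCoord x o ^ 3 / (6 * fullWeight p o ^ 2) - fullCoord x o / (2 * fullWeight p o))

/-- The coefficient of `N^{-1}` in the logarithm of that ratio. -/
def logCorrTwo (p x : Fin d → ℝ) : ℝ :=
  ∑ o, (fullCoord x o ^ 2 / (4 * fullWeight p o ^ 2)
    - fullCoord x o ^ 4 / (12 * fullWeight p o ^ 3)) + (1 - ∑ o, (fullWeight p o)⁻¹) / 12

/-- The coefficient of `N^{-1}` in that ratio. -/
def corrTwo (p x : Fin d → ℝ) : ℝ := corrOne p x ^ 2 / 2 + logCorrTwo p x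

/-- The ratio `Δφ / φ` of the Laplacian of the Gaussian density to the density itself. -/
def laplaceRatio (p x : Fin d → ℝ) : ℝ :=
  ∑ i, ((((covMatrix p)⁻¹ *ᵥ x) i) ^ 2 - (covMatrix p)⁻¹ i i)

theorem sum_linCoef_mul (p x : Fin d → ℝ) :
    ∑ i, linCoef p i * x i = ∑ o, fullCoord x o / fullWeight p o := by
  simp only [linCoef, sub_mul, Finset.sum_sub_distrib, Fintype.sum_option,
    fullCoord_none, fullCoord_some, fullWeight_none, fullWeight_some, one_div_mul_eq_div,
    ← Finset.sum_div]
  ring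

theorem sum_cubCoef_mul (p x : Fin d → ℝ) :
    ∑ i, ∑ j, ∑ l, cubCoef p i j l * (x i * x j * x l)
      = ∑ o, fullCoord x o ^ 3 / fullWeight p o ^ 2 := by
  have h : ∀ i, ∑ j, ∑ l, (if i = j ∧ j = l then 1 / p i ^ 2 else 0) * (x i * x j * x l)
      = x i ^ 3 / p i ^ 2 := fun i => by
    simp [ite_and]
    ring
  simp only [cubCoef, sub_mul, Finset.sum_sub_distrib, h, ← Finset.mul_sum, ← Finset.sum_mul,
    Fintype.sum_option, fullCoord_none, fullCoord_some, fullWeight_none, fullWeight_some]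
  ring

theorem sum_quartCoef_mul (p x : Fin d → ℝ) :
    ∑ i, ∑ j, ∑ l, ∑ m, quartCoef p i j l m * (x i * x j * x l * x m)
      = ∑ o, fullCoord x o ^ 4 / fullWeight p o ^ 3 := by
  have h : ∀ i, ∑ j, ∑ l, ∑ m, (if i = j ∧ j = l ∧ l = m then 1 / p i ^ 3 else 0)
      * (x i * x j * x l * x m) = x i ^ 4 / p i ^ 3 := fun i => by
    simp [ite_and]
    ring
  simp only [quartCoef, add_mul, Finset.sum_add_distrib, h, ← Finset.mul_sum, ← Finset.sum_mul,
    Fintype.sum_option, fullCoord_none, fullCoord_some, fullWeight_none, fullWeight_some]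
  ring

theorem sum_sum_ite_lt (v : Fin d → ℝ) :
    ∑ i, ∑ j, (if i < j then 2 * (v i * v j) else 0) = (∑ i, v i) ^ 2 - ∑ i, v i ^ 2 := by
  have hswap : ∑ i, ∑ j, (if j < i then v i * v j else 0)
      = ∑ i, ∑ j, (if i < j then v i * v j else 0) := by
    rw [Finset.sum_comm]
    simp only [mul_comm]
  have hsplit : (∑ i, v i) ^ 2 = ∑ i, ∑ j, ((if i = j then v i * v j else 0)
      + (if i < j then v i * v j else 0) + (if j < i then v i * v j else 0)) := by
    rw [sq, Finset.sum_mul_sum]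
    refine Finset.sum_congr rfl fun i _ => Finset.sum_congr rfl fun j _ => ?_
    rcases lt_trichotomy i j with h | h | h
    · simp [h, h.ne, h.not_gt]
    · simp [h]
    · simp [h, h.ne', h.not_gt]
  rw [hsplit]
  simp only [Finset.sum_add_distrib, hswap]
  have h2 : ∀ i j, (if i < j then 2 * (v i * v j) else 0) = 2 * (if i < j then v i * v j else 0) :=
    fun i j => by split_ifs <;> simp
  simp only [h2, ← Finset.mul_sum]
  simp [sq]
  ring

theorem sum_quadCoef_mul (p x : Fin d → ℝ) :
    ∑ i, ∑ j, quadCoef p i j * (x i * x j)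
      = (∑ o, fullCoord x o / fullWeight p o) ^ 2
        + 2 * ∑ o, fullCoord x o ^ 2 / fullWeight p o ^ 2 := by
  have h1 : ∀ i, ∑ j, (if i = j then 3 / p i ^ 2 else 0) * (x i * x j) = 3 * (x i / p i) ^ 2 :=
    fun i => by simp; ring
  have h2 : ∑ i, ∑ j, (if i < j then 2 / (p i * p j) else 0) * (x i * x j)
      = (∑ i, x i / p i) ^ 2 - ∑ i, (x i / p i) ^ 2 := by
    rw [← sum_sum_ite_lt]
    refine Finset.sum_congr rfl fun i _ => Finset.sum_congr rfl fun j _ => ?_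
    split_ifs <;> ring
  have h3 : ∑ i, ∑ j, 2 / (p i * qWeight p) * (x i * x j)
      = 2 * (∑ i, x i / p i) * (∑ i, x i) / qWeight p := by
    rw [mul_assoc, Finset.sum_mul_sum, mul_div_assoc, Finset.sum_div, Finset.mul_sum]
    refine Finset.sum_congr rfl fun i _ => ?_
    rw [Finset.sum_div, Finset.mul_sum]
    exact Finset.sum_congr rfl fun j _ => by ring
  simp only [quadCoef, add_mul, sub_mul, Finset.sum_add_distrib, Finset.sum_sub_distrib, h1, h2, h3]
  simp only [← Finset.mul_sum, ← Finset.sum_mul, Fintype.sum_option, fullCoord_none,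
    fullCoord_some, fullWeight_none, fullWeight_some, ← div_pow]
  ring

theorem corrOne_eq (p x : Fin d → ℝ) :
    corrOne p x = -(1 / 2) * (∑ i, linCoef p i * x i)
      + 1 / 6 * ∑ i, ∑ j, ∑ l, cubCoef p i j l * (x i * x j * x l) := by
  rw [sum_linCoef_mul, sum_cubCoef_mul, corrOne, Finset.mul_sum, Finset.mul_sum,
    ← Finset.sum_add_distrib]
  exact Finset.sum_congr rfl fun o _ => by ring

theorem logCorrTwo_eq (p x : Fin d → ℝ) :
    logCorrTwo p x = (∑ o, fullCoord x o ^ 2 / fullWeight p o ^ 2) / 4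
      - (∑ o, fullCoord x o ^ 4 / fullWeight p o ^ 3) / 12
      + (1 - (∑ i, (p i)⁻¹) - (qWeight p)⁻¹) / 12 := by
  have h : ∑ o, (fullWeight p o)⁻¹ = (qWeight p)⁻¹ + ∑ i, (p i)⁻¹ := by
    simp [Fintype.sum_option]
  rw [logCorrTwo, h, Finset.sum_div, Finset.sum_div, ← Finset.sum_sub_distrib]
  congr 1
  · exact Finset.sum_congr rfl fun o _ => by ring
  · ring

theorem corrTwo_eq (p x : Fin d → ℝ) :
    corrTwo p x =
      - 1 / 12 * (∑ i, ∑ j, ∑ l, ∑ m, cubCoef p i j l * linCoef p m * (x i * x j * x l * x m))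
      - 1 / 12 * (∑ i, ∑ j, ∑ l, ∑ m, quartCoef p i j l m * (x i * x j * x l * x m))
      + 1 / 72 * (∑ i, ∑ j, ∑ l, ∑ i', ∑ j', ∑ l', cubCoef p i j l * cubCoef p i' j' l' *
        (x i * x j * x l * x i' * x j' * x l'))
      + 1 / 8 * (∑ i, ∑ j, quadCoef p i j * (x i * x j))
      + 1 / 12 * (1 - (∑ i, (p i)⁻¹) - (qWeight p)⁻¹) := by
  have h4 : ∑ i, ∑ j, ∑ l, ∑ m, cubCoef p i j l * linCoef p m * (x i * x j * x l * x m)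
      = (∑ i, ∑ j, ∑ l, cubCoef p i j l * (x i * x j * x l)) * ∑ m, linCoef p m * x m := by
    simp only [Finset.sum_mul]
    refine Finset.sum_congr rfl fun i _ => Finset.sum_congr rfl fun j _ =>
      Finset.sum_congr rfl fun l _ => ?_
    rw [Finset.mul_sum]
    exact Finset.sum_congr rfl fun m _ => by ring
  have h6 : ∑ i, ∑ j, ∑ l, ∑ i', ∑ j', ∑ l', cubCoef p i j l * cubCoef p i' j' l' *
        (x i * x j * x l * x i' * x j' * x l')
      = (∑ i, ∑ j, ∑ l, cubCoef p i j l * (x i * x j * x l)) *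
        (∑ i, ∑ j, ∑ l, cubCoef p i j l * (x i * x j * x l)) := by
    simp only [Finset.sum_mul]
    refine Finset.sum_congr rfl fun i _ => Finset.sum_congr rfl fun j _ =>
      Finset.sum_congr rfl fun l _ => ?_
    simp only [Finset.mul_sum]
    exact Finset.sum_congr rfl fun i' _ => Finset.sum_congr rfl fun j' _ =>
      Finset.sum_congr rfl fun l' _ => by ring
  rw [h4, h6, corrTwo, corrOne_eq, logCorrTwo_eq, sum_quadCoef_mul, sum_quartCoef_mul,
    sum_linCoef_mul]
  ring

theorem integrableOn_of_continuous {K : Set (Fin d → ℝ)} (hK : IsCompact K)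
    {f : (Fin d → ℝ) → ℝ} (hf : Continuous f) : IntegrableOn f K :=
  hf.continuousOn.integrableOn_compact hK

theorem sum_setIntegral {ι : Type*} [Fintype ι] {K : Set (Fin d → ℝ)} (hK : IsCompact K)
    {f : ι → (Fin d → ℝ) → ℝ} (hf : ∀ i, Continuous (f i)) :
    ∑ i, ∫ y in K, f i y = ∫ y in K, ∑ i, f i y :=
  (integral_finsetSum _ fun i _ => integrableOn_of_continuous hK (hf i)).symm

theorem add_setIntegral {K : Set (Fin d → ℝ)} (hK : IsCompact K)
    {f g : (Fin d → ℝ) → ℝ} (hf : Continuous f) (hg : Continuous g) :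
    (∫ y in K, f y) + ∫ y in K, g y = ∫ y in K, (f y + g y) :=
  (integral_add (integrableOn_of_continuous hK hf) (integrableOn_of_continuous hK hg)).symm

theorem sub_setIntegral {K : Set (Fin d → ℝ)} (hK : IsCompact K)
    {f g : (Fin d → ℝ) → ℝ} (hf : Continuous f) (hg : Continuous g) :
    (∫ y in K, f y) - ∫ y in K, g y = ∫ y in K, (f y - g y) :=
  (integral_sub (integrableOn_of_continuous hK hf) (integrableOn_of_continuous hK hg)).symm

theorem isCompact_cube (N : ℕ) (p : Fin d → ℝ) (k : Fin d → ℕ) : IsCompact (cube N p k) :=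
  isCompact_univ_pi fun _ => isCompact_Icc

theorem isCompact_cubeUnion (N : ℕ) (p : Fin d → ℝ) (A : Set (Fin d → ℕ)) :
    IsCompact (cubeUnion N p A) :=
  (latticePoints N A).isCompact_biUnion fun k _ => isCompact_cube N p k

theorem continuous_fullCoord (o : Option (Fin d)) :
    Continuous fun x : Fin d → ℝ => fullCoord x o := by
  cases o <;> simp <;> fun_prop

theorem continuous_corrOne (p : Fin d → ℝ) : Continuous (corrOne p) := by
  have h := continuous_fullCoord (d := d)
  unfold corrOne
  fun_prop

theorem continuous_corrTwo (p : Fin d → ℝ) : Continuous (corrTwo p) := by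
  have h := continuous_fullCoord (d := d)
  have h1 := continuous_corrOne p
  unfold corrTwo logCorrTwo
  fun_prop

theorem firstCorrection_eq (N : ℕ) (p : Fin d → ℝ) (A : Set (Fin d → ℕ)) :
    firstCorrection N p A = ∫ y in cubeUnion N p A, corrOne p y * gaussDensity p y := by
  have hK := isCompact_cubeUnion N p A
  have hg := continuous_gaussDensity p
  unfold firstCorrection
  simp only [← integral_const_mul]
  simp (disch := first | (intro; fun_prop) | fun_prop) only [sum_setIntegral hK,
    ← integral_const_mul, add_setIntegral hK]
  refine integral_congr_ae (Eventually.of_forall fun y => ?_)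
  simp only [corrOne_eq, add_mul, Finset.sum_mul, Finset.mul_sum, mul_assoc]

theorem secondCorrection_eq (N : ℕ) (p : Fin d → ℝ) (A : Set (Fin d → ℕ)) :
    secondCorrection N p A = -(1 / 24) * (∑ k ∈ latticePoints N A, ∫ y in cube N p k,
        laplaceRatio p (delta N p (toReal k)) * gaussDensity p y)
      + ∫ y in cubeUnion N p A, corrTwo p y * gaussDensity p y := by
  have hK := isCompact_cubeUnion N p A
  have hg := continuous_gaussDensity p
  have h1 : (∑ i, ∑ k ∈ latticePoints N A, (∫ y in cube N p k,
      ((((covMatrix p)⁻¹ *ᵥ delta N p (toReal k)) i) ^ 2 - (covMatrix p)⁻¹ i i) *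
        gaussDensity p y)) = ∑ k ∈ latticePoints N A, ∫ y in cube N p k,
        laplaceRatio p (delta N p (toReal k)) * gaussDensity p y := by
    rw [Finset.sum_comm]
    refine Finset.sum_congr rfl fun k _ => ?_
    rw [sum_setIntegral (isCompact_cube N p k) fun i => by fun_prop]
    simp only [laplaceRatio, Finset.sum_mul]
  unfold secondCorrection
  rw [h1]
  have key : ∀ {a b c d e f I : ℝ}, d - b - c + e + f = I → a - b - c + d + e + f = a + I := by
    intro a b c d e f I h
    rw [← h]; ring
  refine key ?_
  simp only [← integral_const_mul]
  simp (disch := first | (intro; fun_prop) | fun_prop) only [sum_setIntegral hK,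
    ← integral_const_mul, add_setIntegral hK, sub_setIntegral hK]
  refine integral_congr_ae (Eventually.of_forall fun y => ?_)
  simp only [corrTwo_eq]
  simp only [← mul_assoc, ← Finset.sum_mul]
  ring

/-! ### Moments over the unit cube -/

/-- The cube `[-1/2, 1/2]^d`. -/
def unitCube (d : ℕ) : Set (Fin d → ℝ) := Set.univ.pi fun _ => Set.Icc (-(1 / 2)) (1 / 2)

theorem isCompact_unitCube : IsCompact (unitCube d) := isCompact_univ_pi fun _ => isCompact_Icc

theorem measurableSet_unitCube : MeasurableSet (unitCube d) :=
  isCompact_unitCube.isClosed.measurableSet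

theorem volume_unitCube : volume (unitCube d) = 1 := by
  rw [unitCube, volume_pi_pi]
  simp
  norm_num

theorem abs_le_of_mem_unitCube {u : Fin d → ℝ} (hu : u ∈ unitCube d) (i : Fin d) :
    |u i| ≤ 1 / 2 :=
  abs_le.2 (hu i (Set.mem_univ i))

theorem l1Norm_le_of_mem_unitCube {u : Fin d → ℝ} (hu : u ∈ unitCube d) : l1Norm u ≤ d / 2 := by
  refine (Finset.sum_le_sum fun i _ => abs_le_of_mem_unitCube hu i).trans_eq ?_
  simp
  ring

theorem restrict_unitCube : (volume : Measure (Fin d → ℝ)).restrict (unitCube d) =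
    Measure.pi fun _ => (volume : Measure ℝ).restrict (Set.Icc (-(1 / 2)) (1 / 2)) := by
  rw [unitCube, volume_pi, Measure.restrict_pi_pi]

theorem setIntegral_unitCube_of_odd {f : (Fin d → ℝ) → ℝ} (hf : ∀ u, f (-u) = -f u) :
    ∫ u in unitCube d, f u = 0 := by
  have hpre : (fun u : Fin d → ℝ => -u) ⁻¹' unitCube d = unitCube d := by
    ext u
    simp only [unitCube, Set.mem_preimage, Set.mem_univ_pi, Set.mem_Icc, Pi.neg_apply]
    exact forall_congr' fun i => ⟨fun h => ⟨by linarith, by linarith⟩,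
      fun h => ⟨by linarith, by linarith⟩⟩
  have h := (Measure.measurePreserving_neg (volume : Measure (Fin d → ℝ))).setIntegral_preimage_emb
    (MeasurableEquiv.neg (Fin d → ℝ)).measurableEmbedding f (unitCube d)
  rw [hpre] at h
  simp only [hf, integral_neg] at h
  linarith

theorem integral_id_Icc : ∫ t in Set.Icc (-(1 / 2) : ℝ) (1 / 2), t = 0 := by
  rw [integral_Icc_eq_integral_Ioc, ← intervalIntegral.integral_of_le (by norm_num), integral_id]
  norm_num

theorem integral_sq_Icc : ∫ t in Set.Icc (-(1 / 2) : ℝ) (1 / 2), t ^ 2 = 1 / 12 := by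
  rw [integral_Icc_eq_integral_Ioc, ← intervalIntegral.integral_of_le (by norm_num), integral_pow]
  norm_num

theorem integral_one_Icc : ∫ _ in Set.Icc (-(1 / 2) : ℝ) (1 / 2), (1 : ℝ) = 1 := by
  simp
  norm_num

theorem setIntegral_unitCube_mul (i j : Fin d) :
    ∫ u in unitCube d, u i * u j = if i = j then 1 / 12 else 0 := by
  have h : ∀ u : Fin d → ℝ, u i * u j =
      ∏ m, (if m = i then u m else 1) * (if m = j then u m else 1) := fun u => by
    rw [Finset.prod_mul_distrib]
    simp
  simp only [h]
  rw [restrict_unitCube, integral_fintype_prod_eq_prod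
    (f := fun (m : Fin d) (t : ℝ) => (if m = i then t else 1) * (if m = j then t else 1))]
  split_ifs with hij
  · subst hij
    rw [Finset.prod_eq_single i]
    · simpa [← sq] using integral_sq_Icc
    · intro m _ hm
      simpa [hm] using integral_one_Icc
    · simp
  · refine Finset.prod_eq_zero (Finset.mem_univ i) ?_
    simpa [hij] using integral_id_Icc

/-- The second moment of a linear form on the cube `[-1/2, 1/2]^d`. -/
theorem setIntegral_unitCube_sq (v : Fin d → ℝ) :
    ∫ u in unitCube d, (∑ i, v i * u i) ^ 2 = (∑ i, v i ^ 2) / 12 := by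
  have h : ∀ u : Fin d → ℝ, (∑ i, v i * u i) ^ 2 = ∑ i, ∑ j, v i * v j * (u i * u j) := fun u => by
    rw [sq, Finset.sum_mul_sum]
    exact Finset.sum_congr rfl fun i _ => Finset.sum_congr rfl fun j _ => by ring
  simp only [h]
  rw [← sum_setIntegral isCompact_unitCube fun i => by fun_prop]
  have h2 : ∀ i, ∫ u in unitCube d, ∑ j, v i * v j * (u i * u j) = v i ^ 2 / 12 := fun i => by
    rw [← sum_setIntegral isCompact_unitCube fun i => by fun_prop]
    simp only [integral_const_mul, setIntegral_unitCube_mul]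
    simp
    ring
  simp only [h2, Finset.sum_div]

theorem continuous_covForm (p : Fin d → ℝ) {f g : (Fin d → ℝ) → Fin d → ℝ} (hf : Continuous f)
    (hg : Continuous g) : Continuous fun u => covForm p (f u) (g u) := by
  simp only [covForm_eq]
  fun_prop

theorem covForm_eq_sum {p : Fin d → ℝ} (hp : ∀ i, p i ∈ Set.Ioo (0 : ℝ) 1) (hsum : ∑ i, p i < 1)
    (x u : Fin d → ℝ) : covForm p x u = ∑ i, ((covMatrix p)⁻¹ *ᵥ x) i * u i := by
  rw [covForm_comm, ← dotProduct_covMatrix_inv_mulVec hp hsum, dotProduct]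
  simp only [mul_comm]

theorem setIntegral_covForm_self {p : Fin d → ℝ} (hp : ∀ i, p i ∈ Set.Ioo (0 : ℝ) 1)
    (hsum : ∑ i, p i < 1) :
    ∫ u in unitCube d, covForm p u u = (∑ i, (covMatrix p)⁻¹ i i) / 12 := by
  have h : ∀ u : Fin d → ℝ, covForm p u u =
      ∑ i, u i * u i / p i + (∑ i, 1 * u i) ^ 2 / qWeight p := fun u => by
    rw [covForm_eq]
    simp only [one_mul]
    ring
  simp only [h]
  rw [← add_setIntegral isCompact_unitCube (by fun_prop) (by fun_prop),
    ← sum_setIntegral isCompact_unitCube fun i => by fun_prop, integral_div,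
    setIntegral_unitCube_sq]
  simp only [integral_div, setIntegral_unitCube_mul, covMatrix_inv hp hsum, Matrix.add_apply,
    Matrix.diagonal_apply_eq, Matrix.of_apply, Finset.sum_add_distrib]
  simp only [if_true, one_pow, add_div, Finset.sum_div, Finset.sum_const, nsmul_eq_mul]
  congr 1
  · exact Finset.sum_congr rfl fun i _ => by ring
  · ring

/-- The derivative of `corrOne p` at `x` in the direction `u`. -/
def corrOneDeriv (p x u : Fin d → ℝ) : ℝ :=
  ∑ o, (fullCoord x o ^ 2 * fullCoord u o / (2 * fullWeight p o ^ 2)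
    - fullCoord u o / (2 * fullWeight p o))

/-- The part of the Taylor expansion around `x` that has mean zero over the cube. -/
def meanZeroPart (p : Fin d → ℝ) (s : ℝ) (x u : Fin d → ℝ) : ℝ :=
  -(s * covForm p x u) + s ^ 2 * (covForm p x u ^ 2 / 2 - covForm p u u / 2
    - laplaceRatio p x / 24 + corrOneDeriv p x u - corrOne p x * covForm p x u)

theorem continuous_meanZeroPart (p : Fin d → ℝ) (s : ℝ) (x : Fin d → ℝ) :
    Continuous (meanZeroPart p s x) := by
  have h1 := continuous_covForm p (continuous_const (y := x)) continuous_id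
  have h2 := continuous_covForm p (continuous_id (X := Fin d → ℝ)) continuous_id
  have h3 := continuous_fullCoord (d := d)
  simp only [id] at h1 h2
  unfold meanZeroPart corrOneDeriv
  fun_prop

/-- The quadratic part has mean zero because the average of `½ (D²φ) / φ` over the cube is one
24th of the Laplacian; the remaining terms are odd. -/
theorem setIntegral_meanZeroPart {p : Fin d → ℝ} (hp : ∀ i, p i ∈ Set.Ioo (0 : ℝ) 1)
    (hsum : ∑ i, p i < 1) (s : ℝ) (x : Fin d → ℝ) :
    ∫ u in unitCube d, meanZeroPart p s x u = 0 := by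
  have h1 := continuous_covForm p (continuous_const (y := x)) continuous_id
  have h2 := continuous_covForm p (continuous_id (X := Fin d → ℝ)) continuous_id
  have h3 := continuous_fullCoord (d := d)
  simp only [id] at h1 h2
  have hneg : ∀ u o, fullCoord (-u : Fin d → ℝ) o = -fullCoord u o := fun u o => by
    simpa using fullCoord_smul (-1) u o
  have hodd : ∫ u in unitCube d, (-(s * covForm p x u) + s ^ 2 *
      (corrOneDeriv p x u - corrOne p x * covForm p x u)) = 0 := by
    refine setIntegral_unitCube_of_odd fun u => ?_
    have hc : covForm p x (-u) = -covForm p x u := by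
      simp only [covForm, hneg, mul_neg, neg_div, Finset.sum_neg_distrib]
    have hd : corrOneDeriv p x (-u) = -corrOneDeriv p x u := by
      simp only [corrOneDeriv, hneg, mul_neg, neg_div, ← Finset.sum_neg_distrib]
      exact Finset.sum_congr rfl fun o _ => by ring
    rw [hc, hd]
    ring
  have heven : ∫ u in unitCube d,
      (covForm p x u ^ 2 / 2 - covForm p u u / 2 - laplaceRatio p x / 24) = 0 := by
    rw [← sub_setIntegral isCompact_unitCube (by fun_prop) (by fun_prop),
      ← sub_setIntegral isCompact_unitCube (by fun_prop) (by fun_prop), integral_div, integral_div,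
      setIntegral_covForm_self hp hsum, setIntegral_const, measureReal_def, volume_unitCube]
    simp only [covForm_eq_sum hp hsum x]
    rw [setIntegral_unitCube_sq, laplaceRatio, Finset.sum_sub_distrib]
    simp
    ring
  have hsplit : ∀ u, meanZeroPart p s x u = (-(s * covForm p x u) + s ^ 2 *
      (corrOneDeriv p x u - corrOne p x * covForm p x u)) + s ^ 2 *
      (covForm p x u ^ 2 / 2 - covForm p u u / 2 - laplaceRatio p x / 24) := fun u => by
    unfold meanZeroPart
    ring
  simp only [hsplit]
  rw [← add_setIntegral isCompact_unitCube (by unfold corrOneDeriv; fun_prop) (by fun_prop), hodd,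
    integral_const_mul, heven]
  ring

/-! ### The midpoint rule for the corrected Gaussian density -/

/-- The parameters of the Gaussian expansion inside a cube: the mesh `s`, the centre `x` and the
relative position `u` in the cube. -/
def CubeParam (d : ℕ) : Type :=
  {ω : ℝ × (Fin d → ℝ) × (Fin d → ℝ) // (0 < ω.1 ∧ ω.1 ≤ 1) ∧ ω.2.2 ∈ unitCube d}

namespace CubeParam

/-- The mesh. -/
def s (ω : CubeParam d) : ℝ := ω.1.1

/-- The centre of the cube. -/
def x (ω : CubeParam d) : Fin d → ℝ := ω.1.2.1

/-- The relative position in the cube. -/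
def u (ω : CubeParam d) : Fin d → ℝ := ω.1.2.2

end CubeParam

/-- Orders in the mesh, with growth measured by the norm of the centre of the cube. -/
def cubeScale (d : ℕ) : Scale (CubeParam d) where
  s := CubeParam.s
  size := fun ω => l1Norm ω.x
  s_pos := fun ω => ω.2.1.1
  s_le_one := fun ω => ω.2.1.2
  size_nonneg := fun _ => l1Norm_nonneg _

open Scale

section Polynomials

variable {Ω : Type*} {σ : Scale Ω} {X : Ω → Fin d → ℝ}

theorem isO_corrOne (p : Fin d → ℝ) (hX : ∀ o, σ.IsO 0 fun ω => fullCoord (X ω) o) :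
    σ.IsO 0 fun ω => corrOne p (X ω) :=
  IsO.sum _ fun o _ => (((hX o).pow 3).div_const _).sub ((hX o).div_const _)

theorem isO_logCorrTwo (p : Fin d → ℝ) (hX : ∀ o, σ.IsO 0 fun ω => fullCoord (X ω) o) :
    σ.IsO 0 fun ω => logCorrTwo p (X ω) :=
  (IsO.sum _ fun o _ => (((hX o).pow 2).div_const _).sub (((hX o).pow 4).div_const _)).add
    (isO_const _)

theorem isO_corrTwo (p : Fin d → ℝ) (hX : ∀ o, σ.IsO 0 fun ω => fullCoord (X ω) o) :
    σ.IsO 0 fun ω => corrTwo p (X ω) :=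
  (((isO_corrOne p hX).pow 2).div_const 2).add (isO_logCorrTwo p hX)

theorem isO_covForm (p : Fin d → ℝ) {Y : Ω → Fin d → ℝ}
    (hX : ∀ o, σ.IsO 0 fun ω => fullCoord (X ω) o) (hY : ∀ o, σ.IsO 0 fun ω => fullCoord (Y ω) o) :
    σ.IsO 0 fun ω => covForm p (X ω) (Y ω) :=
  IsO.sum _ fun o _ => ((hX o).mul (hY o)).div_const _

theorem isO_laplaceRatio {p : Fin d → ℝ} (hp : ∀ i, p i ∈ Set.Ioo (0 : ℝ) 1)
    (hsum : ∑ i, p i < 1) (hX : ∀ o, σ.IsO 0 fun ω => fullCoord (X ω) o) :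
    σ.IsO 0 fun ω => laplaceRatio p (X ω) := by
  refine IsO.sum _ fun i _ => IsO.sub (IsO.pow (n := 0) ?_ 2) (isO_const _)
  refine (((hX (some i)).div_const (p i)).sub ((hX none).div_const (qWeight p))).congr fun ω => ?_
  rw [covMatrix_inv_mulVec hp hsum]
  simp
  ring

end Polynomials

theorem isO_fullCoord_x (o : Option (Fin d)) :
    (cubeScale d).IsO 0 fun ω => fullCoord ω.x o :=
  isO_of_abs_le_size (c := 1) fun ω => by
    have h := abs_fullCoord_le ω.x o
    change |fullCoord ω.x o| ≤ 1 * (1 + l1Norm ω.x)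
    linarith

theorem abs_fullCoord_u_le (ω : CubeParam d) (o : Option (Fin d)) : |fullCoord ω.u o| ≤ d / 2 :=
  (abs_fullCoord_le ω.u o).trans (l1Norm_le_of_mem_unitCube ω.2.2)

theorem isO_fullCoord_u (o : Option (Fin d)) :
    (cubeScale d).IsO 0 fun ω => fullCoord ω.u o :=
  isO_of_bounded fun ω => abs_fullCoord_u_le ω o

theorem isO_fullCoord_shift_sub (o : Option (Fin d)) :
    (cubeScale d).IsO 1 fun ω => fullCoord (ω.x + ω.s • ω.u) o - fullCoord ω.x o :=
  (isO_s.mul (isO_fullCoord_u o)).congr fun ω => by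
    rw [fullCoord_add, fullCoord_smul, add_sub_cancel_left]
    rfl

theorem isO_fullCoord_shift (o : Option (Fin d)) :
    (cubeScale d).IsO 0 fun ω => fullCoord (ω.x + ω.s • ω.u) o :=
  (((isO_fullCoord_shift_sub o).mono zero_le_one).add (isO_fullCoord_x o)).congr fun ω => by ring

theorem isO_corrOneDeriv (p : Fin d → ℝ) :
    (cubeScale d).IsO 0 fun ω => corrOneDeriv p ω.x ω.u :=
  IsO.sum _ fun o _ => ((((isO_fullCoord_x o).pow 2).mul (isO_fullCoord_u o)).div_const _).sub
    ((isO_fullCoord_u o).div_const _)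

theorem isO_corrOne_shift_sub_deriv (p : Fin d → ℝ) :
    (cubeScale d).IsO 2 fun ω => corrOne p (ω.x + ω.s • ω.u) -
      (corrOne p ω.x + ω.s * corrOneDeriv p ω.x ω.u) := by
  have h : (cubeScale d).IsO 2 fun ω => ∑ o, (3 * (fullCoord ω.x o * fullCoord ω.u o ^ 2)
      + fullCoord ω.u o ^ 2 * (fullCoord ω.u o * ω.s)) / (6 * fullWeight p o ^ 2) * ω.s ^ 2 := by
    refine IsO.sum _ fun o _ => IsO.of_mul_pow_s (n := 0) (IsO.div_const ?_ _) 2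
    exact (((isO_fullCoord_x o).mul ((isO_fullCoord_u o).pow 2)).const_mul 3).add
      (((isO_fullCoord_u o).pow 2).mul (((isO_fullCoord_u o).mul isO_s).mono zero_le_one))
  refine h.congr fun ω => ?_
  rw [corrOne, corrOne, corrOneDeriv, Finset.mul_sum, ← Finset.sum_add_distrib,
    ← Finset.sum_sub_distrib]
  refine Finset.sum_congr rfl fun o _ => ?_
  rw [fullCoord_add, fullCoord_smul]
  ring

theorem isO_corrOne_shift_sub (p : Fin d → ℝ) :
    (cubeScale d).IsO 1 fun ω => corrOne p (ω.x + ω.s • ω.u) - corrOne p ω.x :=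
  (((isO_corrOne_shift_sub_deriv p).mono one_le_two).add (isO_s.mul (isO_corrOneDeriv p))).congr
    fun ω => by change _ = _ + ω.s * _; ring

theorem isO_logCorrTwo_shift_sub (p : Fin d → ℝ) :
    (cubeScale d).IsO 1 fun ω => logCorrTwo p (ω.x + ω.s • ω.u) - logCorrTwo p ω.x := by
  have h : (cubeScale d).IsO 1 fun ω => ∑ o,
      ((fullCoord (ω.x + ω.s • ω.u) o - fullCoord ω.x o) *
          (fullCoord (ω.x + ω.s • ω.u) o + fullCoord ω.x o) / (4 * fullWeight p o ^ 2)
        - (fullCoord (ω.x + ω.s • ω.u) o - fullCoord ω.x o) *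
          ((fullCoord (ω.x + ω.s • ω.u) o + fullCoord ω.x o) *
            (fullCoord (ω.x + ω.s • ω.u) o ^ 2 + fullCoord ω.x o ^ 2))
          / (12 * fullWeight p o ^ 3)) := by
    refine IsO.sum _ fun o _ => ?_
    have hs := (isO_fullCoord_shift o).add (isO_fullCoord_x o)
    exact (((isO_fullCoord_shift_sub o).mul hs).div_const _).sub
      (((isO_fullCoord_shift_sub o).mul (hs.mul
        (((isO_fullCoord_shift o).pow 2).add ((isO_fullCoord_x o).pow 2)))).div_const _)
  refine h.congr fun ω => ?_
  rw [logCorrTwo, logCorrTwo, add_sub_add_right_eq_sub, ← Finset.sum_sub_distrib]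
  exact Finset.sum_congr rfl fun o _ => by ring

theorem isO_corrTwo_shift_sub (p : Fin d → ℝ) :
    (cubeScale d).IsO 1 fun ω => corrTwo p (ω.x + ω.s • ω.u) - corrTwo p ω.x := by
  have h := (((isO_corrOne_shift_sub p).mul ((isO_corrOne p isO_fullCoord_shift).add
    (isO_corrOne p isO_fullCoord_x))).div_const 2).add (isO_logCorrTwo_shift_sub p)
  refine h.congr fun ω => ?_
  rw [corrTwo, corrTwo]
  ring

/-- The logarithm of the ratio of the Gaussian densities at `x + s u` and at `x`. -/
def shiftExponent (p : Fin d → ℝ) (s : ℝ) (x u : Fin d → ℝ) : ℝ :=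
  -(s * covForm p x u) - s ^ 2 * covForm p u u / 2

theorem isO_shiftExponent (p : Fin d → ℝ) :
    (cubeScale d).IsO 1 fun ω => shiftExponent p ω.s ω.x ω.u :=
  (((isO_covForm p isO_fullCoord_x isO_fullCoord_u).of_mul_pow_s 1).neg.sub
    ((((isO_covForm p isO_fullCoord_u isO_fullCoord_u).of_mul_pow_s 2).mono
      one_le_two).div_const 2)).congr fun ω => by
    change _ = -(_ * ω.s ^ 1) - _ * ω.s ^ 2 / 2
    rw [shiftExponent]
    ring

theorem exists_abs_shiftExponent_le {p : Fin d → ℝ} (hp : ∀ i, p i ∈ Set.Ioo (0 : ℝ) 1)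
    (hsum : ∑ i, p i < 1) :
    ∃ c : ℝ, ∀ ω : CubeParam d, |shiftExponent p ω.s ω.x ω.u| ≤ c * (1 + l1Norm ω.x) := by
  set W := ∑ o, (fullWeight p o)⁻¹ with hW
  have hpos := fun o => (inv_pos.2 (fullWeight_pos hp hsum o)).le
  have hW0 : 0 ≤ W := Finset.sum_nonneg fun o _ => hpos o
  have key : ∀ (ω : CubeParam d) (x : Fin d → ℝ),
      |covForm p x ω.u| ≤ l1Norm x * (d / 2) * W := fun ω x => by
    refine (Finset.abs_sum_le_sum_abs _ _).trans ?_
    rw [hW, Finset.mul_sum]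
    refine Finset.sum_le_sum fun o _ => ?_
    rw [abs_div, abs_mul, abs_of_pos (fullWeight_pos hp hsum o), div_eq_mul_inv]
    have h1 := abs_fullCoord_le x o
    have h2 := abs_fullCoord_u_le ω o
    have h3 := hpos o
    have h4 := l1Norm_nonneg x
    gcongr
  refine ⟨d / 2 * W + d / 2 * (d / 2) * W, fun ω => ?_⟩
  have h1 := key ω ω.x
  have h2 := (key ω ω.u).trans (mul_le_mul_of_nonneg_right
    (mul_le_mul_of_nonneg_right (l1Norm_le_of_mem_unitCube ω.2.2) (by positivity)) hW0)
  have hs0 : 0 < ω.s := ω.2.1.1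
  have hs1 : ω.s ≤ 1 := ω.2.1.2
  have hl := l1Norm_nonneg ω.x
  have hs2 : ω.s ^ 2 ≤ 1 := pow_le_one₀ hs0.le hs1
  rw [shiftExponent]
  have h3 : |-(ω.s * covForm p ω.x ω.u) - ω.s ^ 2 * covForm p ω.u ω.u / 2|
      ≤ ω.s * |covForm p ω.x ω.u| + ω.s ^ 2 * |covForm p ω.u ω.u| / 2 := by
    refine (abs_sub _ _).trans_eq ?_
    rw [abs_neg, abs_mul, abs_div, abs_mul, abs_of_pos hs0, abs_of_pos (pow_pos hs0 2),
      abs_of_pos (by norm_num : (0 : ℝ) < 2)]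
  have h4 : ω.s * |covForm p ω.x ω.u| ≤ l1Norm ω.x * (d / 2) * W :=
    (mul_le_of_le_one_left (abs_nonneg _) hs1).trans h1
  have h5 : ω.s ^ 2 * |covForm p ω.u ω.u| ≤ d / 2 * (d / 2) * W :=
    (mul_le_of_le_one_left (abs_nonneg _) hs2).trans h2
  have h6 : 0 ≤ (d : ℝ) / 2 * W := by positivity
  have h7 : 0 ≤ (d : ℝ) / 2 * (d / 2) * W := by positivity
  have h8 : 0 ≤ (d : ℝ) / 2 * (d / 2) * W * l1Norm ω.x := by positivity
  nlinarith

/-- The corrections inside the cube integrals, divided by the mesh and by `φ(x)`. -/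
def innerCorr (p : Fin d → ℝ) (s : ℝ) (x u : Fin d → ℝ) : ℝ :=
  corrOne p (x + s • u) + s * (corrTwo p (x + s • u) - laplaceRatio p x / 24)

theorem isO_innerCorr {p : Fin d → ℝ} (hp : ∀ i, p i ∈ Set.Ioo (0 : ℝ) 1) (hsum : ∑ i, p i < 1) :
    (cubeScale d).IsO 0 fun ω => innerCorr p ω.s ω.x ω.u :=
  (isO_corrOne p isO_fullCoord_shift).add ((isO_s.mul ((isO_corrTwo p isO_fullCoord_shift).sub
    ((isO_laplaceRatio hp hsum isO_fullCoord_x).div_const 24))).mono zero_le_one)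

theorem isO_exp_shiftExponent {p : Fin d → ℝ} (hp : ∀ i, p i ∈ Set.Ioo (0 : ℝ) 1)
    (hsum : ∑ i, p i < 1) :
    (cubeScale d).IsO 0 fun ω => Real.exp (shiftExponent p ω.s ω.x ω.u) := by
  obtain ⟨c, hc⟩ := exists_abs_shiftExponent_le hp hsum
  have hw := isO_shiftExponent (d := d) p
  have hw0 := hw.mono zero_le_one
  have := ((hw.exp_taylor hc).mono (Nat.zero_le 3)).add
    (((isO_const 1).add hw0).add ((hw0.pow 2).div_const 2))
  exact this.congr fun ω => by ring

/-- Expansion of the corrected density at `x + s u` around `x`: up to `O(s³)` it is the corrected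
density at `x` plus a term with mean zero over the cube. -/
theorem isO_expansion {p : Fin d → ℝ} (hp : ∀ i, p i ∈ Set.Ioo (0 : ℝ) 1) (hsum : ∑ i, p i < 1) :
    (cubeScale d).IsO 3 fun ω =>
      (1 + ω.s * innerCorr p ω.s ω.x ω.u) * Real.exp (shiftExponent p ω.s ω.x ω.u)
        - (1 + ω.s * corrOne p ω.x + ω.s ^ 2 * corrTwo p ω.x) - meanZeroPart p ω.s ω.x ω.u := by
  obtain ⟨c, hc⟩ := exists_abs_shiftExponent_le hp hsum
  have hs : (cubeScale d).IsO 1 fun ω => ω.s := isO_s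
  have hw := isO_shiftExponent (d := d) p
  have hw0 := hw.mono zero_le_one
  have hexp := hw.exp_taylor hc
  have hin := isO_innerCorr hp hsum
  have hB := (isO_const (σ := cubeScale d) 1).add ((hs.mul hin).mono zero_le_one)
  have hP := isO_corrOne p (isO_fullCoord_x (d := d))
  have hT := isO_corrTwo p (isO_fullCoord_x (d := d))
  have hD := (isO_laplaceRatio hp hsum (isO_fullCoord_x (d := d))).div_const 24
  have hL := isO_corrOneDeriv (d := d) p
  have hΛ := isO_covForm p (isO_fullCoord_x (d := d)) isO_fullCoord_u
  have hQ := isO_covForm p (isO_fullCoord_u (d := d)) isO_fullCoord_u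
  have hρ1 := isO_corrOne_shift_sub_deriv (d := d) p
  have hρ2 := isO_corrTwo_shift_sub (d := d) p
  have hV := (hL.add hT).sub hD
  have hw2 := (hw.pow 2).div_const 2
  have ha := hB.mul hexp
  have hb := ((hs.mul hρ1).add ((hs.pow 2).mul hρ2)).mul
    (((isO_const 1).add hw0).add ((hw0.pow 2).div_const 2))
  have hs0 := hs.mono zero_le_one
  have hc3 := (hs.pow 3).mul ((((((hV.mul hΛ).neg).sub ((hP.mul hQ).div_const 2)).sub
    ((hs0.mul (hV.mul hQ)).div_const 2)).add ((hΛ.mul hQ).div_const 2)).add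
      ((hs0.mul (hQ.pow 2)).div_const 8))
  have hd3 := (hs.mul hP).mul hw2
  have he3 := (((hs.pow 2).mul hV).mul hw2).mono (show 3 ≤ 1 * 2 + 0 + 1 * 2 by norm_num)
  refine ((((ha.add hb).add hc3).add hd3).add he3).congr fun ω => ?_
  simp only [innerCorr, meanZeroPart]
  generalize Real.exp (shiftExponent p ω.s ω.x ω.u) = E
  simp only [shiftExponent]
  ring

theorem continuous_shiftExponent (p : Fin d → ℝ) (s : ℝ) (x : Fin d → ℝ) :
    Continuous (shiftExponent p s x) := by
  have h1 := continuous_covForm p (continuous_const (y := x)) continuous_id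
  have h2 := continuous_covForm p (continuous_id (X := Fin d → ℝ)) continuous_id
  simp only [id] at h1 h2
  unfold shiftExponent
  fun_prop

theorem continuous_innerCorr (p : Fin d → ℝ) (s : ℝ) (x : Fin d → ℝ) :
    Continuous (innerCorr p s x) := by
  have h1 := continuous_corrOne p
  have h2 := continuous_corrTwo p
  unfold innerCorr
  fun_prop

theorem abs_setIntegral_unitCube_le {f : (Fin d → ℝ) → ℝ} {B : ℝ}
    (h : ∀ u ∈ unitCube d, |f u| ≤ B) : |∫ u in unitCube d, f u| ≤ B := by
  have := norm_setIntegral_le_of_norm_le_const (μ := volume) (s := unitCube d) (f := f) (C := B)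
    (by rw [volume_unitCube]; exact ENNReal.one_lt_top) h
  simpa [measureReal_def, volume_unitCube] using this

/-- The midpoint rule for the corrected Gaussian density on a cube of mesh `s`, after rescaling
the cube to `[-1/2, 1/2]^d`. -/
theorem exists_midpoint_bound {p : Fin d → ℝ} (hp : ∀ i, p i ∈ Set.Ioo (0 : ℝ) 1)
    (hsum : ∑ i, p i < 1) :
    ∃ C : ℝ, 0 ≤ C ∧ ∀ (s : ℝ) (x : Fin d → ℝ), 0 < s → s ≤ 1 →
      |(∫ u in unitCube d, (1 + s * innerCorr p s x u) * gaussDensity p (x + s • u))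
        - gaussDensity p x * (1 + s * corrOne p x + s ^ 2 * corrTwo p x)|
      ≤ C * s ^ 3 * (gaussDensity p x * Real.exp (C * l1Norm x)) := by
  obtain ⟨C, hC, h⟩ := isO_expansion hp hsum
  refine ⟨C, hC, fun s x hs0 hs1 => ?_⟩
  have hg := gaussDensity_pos hp hsum x
  have hw := continuous_shiftExponent p s x
  have hin := continuous_innerCorr p s x
  have hm := continuous_meanZeroPart p s x
  set t := 1 + s * corrOne p x + s ^ 2 * corrTwo p x
  have e : (∫ u in unitCube d, (1 + s * innerCorr p s x u) * gaussDensity p (x + s • u))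
      - gaussDensity p x * t = gaussDensity p x * ∫ u in unitCube d,
        ((1 + s * innerCorr p s x u) * Real.exp (shiftExponent p s x u) - t
          - meanZeroPart p s x u) := by
    rw [← sub_setIntegral isCompact_unitCube (by fun_prop) hm, setIntegral_meanZeroPart hp hsum,
      ← sub_setIntegral isCompact_unitCube (by fun_prop) (by fun_prop), setIntegral_const,
      measureReal_def, volume_unitCube, sub_zero, mul_sub, ← integral_const_mul]
    congr 1
    · refine integral_congr_ae (Eventually.of_forall fun u => ?_)
      simp only [gaussDensity_add_smul hp hsum, shiftExponent]
      ring
    · simp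
  rw [e, abs_mul, abs_of_pos hg]
  have hb := abs_setIntegral_unitCube_le (B := C * s ^ 3 * Real.exp (C * l1Norm x)) (f := fun u =>
    (1 + s * innerCorr p s x u) * Real.exp (shiftExponent p s x u) - t - meanZeroPart p s x u)
    fun u hu => h ⟨(s, x, u), ⟨hs0, hs1⟩, hu⟩
  calc _ ≤ gaussDensity p x * (C * s ^ 3 * Real.exp (C * l1Norm x)) := by gcongr
    _ = _ := by ring

/-- A Gaussian integral over a cube is controlled by the value of the density at the centre. -/
theorem exists_cube_integral_bound {p : Fin d → ℝ} (hp : ∀ i, p i ∈ Set.Ioo (0 : ℝ) 1)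
    (hsum : ∑ i, p i < 1) {F : ℝ → (Fin d → ℝ) → (Fin d → ℝ) → ℝ}
    (hF : (cubeScale d).IsO 0 fun ω => F ω.s ω.x ω.u) :
    ∃ C : ℝ, 0 ≤ C ∧ ∀ (s : ℝ) (x : Fin d → ℝ), 0 < s → s ≤ 1 →
      |∫ u in unitCube d, F s x u * gaussDensity p (x + s • u)|
      ≤ C * (gaussDensity p x * Real.exp (C * l1Norm x)) := by
  obtain ⟨C, hC, h⟩ := hF.mul (isO_exp_shiftExponent hp hsum)
  refine ⟨C, hC, fun s x hs0 hs1 => abs_setIntegral_unitCube_le fun u hu => ?_⟩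
  have hg := gaussDensity_pos hp hsum x
  have hb : |F s x u * Real.exp (shiftExponent p s x u)| ≤ C * s ^ 0 * Real.exp (C * l1Norm x) :=
    h ⟨(s, x, u), ⟨hs0, hs1⟩, hu⟩
  have e : F s x u * gaussDensity p (x + s • u) =
      gaussDensity p x * (F s x u * Real.exp (shiftExponent p s x u)) := by
    rw [gaussDensity_add_smul hp hsum, shiftExponent]
    ring
  rw [e, abs_mul, abs_of_pos hg]
  calc _ ≤ gaussDensity p x * (C * s ^ 0 * Real.exp (C * l1Norm x)) := by gcongr
    _ = _ := by ring

/-! ### Normalized lattice cubes -/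

/-- The side length `N^{-1/2}` of the normalized cubes. -/
def mesh (N : ℕ) : ℝ := (√(N : ℝ))⁻¹

theorem mesh_pos {N : ℕ} (hN : 1 ≤ N) : 0 < mesh N := by
  have : (0 : ℝ) < N := by exact_mod_cast hN
  unfold mesh
  positivity

theorem mesh_le_one {N : ℕ} (hN : 1 ≤ N) : mesh N ≤ 1 :=
  inv_le_one_of_one_le₀ (Real.one_le_sqrt.2 (by exact_mod_cast hN))

theorem mesh_sq (N : ℕ) : mesh N ^ 2 = (N : ℝ)⁻¹ := by
  rw [mesh, inv_pow, Real.sq_sqrt N.cast_nonneg]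

theorem mul_mesh_sq {N : ℕ} (hN : 1 ≤ N) : (N : ℝ) * mesh N ^ 2 = 1 := by
  have : (N : ℝ) ≠ 0 := by exact_mod_cast (by omega : N ≠ 0)
  rw [mesh_sq, mul_inv_cancel₀ this]

theorem rpow_neg_half (N : ℕ) : (N : ℝ) ^ (-(1 / 2) : ℝ) = mesh N := by
  rw [Real.rpow_neg N.cast_nonneg, mesh, Real.sqrt_eq_rpow]

theorem rpow_neg_three_half (N : ℕ) : (N : ℝ) ^ (-(3 / 2) : ℝ) = mesh N ^ 3 := by
  rw [Real.rpow_neg N.cast_nonneg, mesh, Real.sqrt_eq_rpow, inv_pow, ← Real.rpow_natCast,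
    ← Real.rpow_mul N.cast_nonneg]
  norm_num

theorem delta_eq (N : ℕ) (p x : Fin d → ℝ) (i : Fin d) :
    delta N p x i = (x i - N * p i) * mesh N := rfl

/-- The normalized lattice point `δ_k`. -/
abbrev centre (N : ℕ) (p : Fin d → ℝ) (k : Fin d → ℕ) : Fin d → ℝ := delta N p (toReal k)

theorem add_mem_cube_iff {N : ℕ} (hN : 1 ≤ N) (p : Fin d → ℝ) (k : Fin d → ℕ) (z : Fin d → ℝ) :
    centre N p k + z ∈ cube N p k ↔ z ∈ mesh N • unitCube d := by
  have hs := mesh_pos hN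
  rw [Set.mem_smul_set_iff_inv_smul_mem₀ hs.ne']
  simp only [cube, unitCube, Set.mem_univ_pi, Set.mem_Icc, Pi.add_apply, Pi.smul_apply, delta_eq,
    smul_eq_mul, toReal]
  refine forall_congr' fun i => ?_
  have e : (mesh N)⁻¹ * z i = z i / mesh N := by rw [div_eq_inv_mul]
  rw [e, le_div_iff₀ hs, div_le_iff₀ hs]
  constructor
  · rintro ⟨h1, h2⟩
    constructor <;> nlinarith
  · rintro ⟨h1, h2⟩
    constructor <;> nlinarith

theorem setIntegral_cube {N : ℕ} (hN : 1 ≤ N) (p : Fin d → ℝ) (k : Fin d → ℕ)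
    (F : (Fin d → ℝ) → ℝ) :
    ∫ y in cube N p k, F y =
      mesh N ^ d * ∫ u in unitCube d, F (centre N p k + mesh N • u) := by
  have hs := mesh_pos hN
  have h1 := Measure.setIntegral_comp_smul_of_pos (volume : Measure (Fin d → ℝ))
    (fun z => F (centre N p k + z)) (unitCube d) hs
  have h2 := (measurePreserving_add_left (volume : Measure (Fin d → ℝ))
    (centre N p k)).setIntegral_preimage_emb (measurableEmbedding_addLeft _) F (cube N p k)
  have h3 : (fun z => centre N p k + z) ⁻¹' cube N p k = mesh N • unitCube d :=
    Set.ext fun z => add_mem_cube_iff hN p k z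
  rw [h3] at h2
  rw [h1, h2, Module.finrank_fin_fun, smul_eq_mul, ← mul_assoc,
    mul_inv_cancel₀ (pow_pos hs d).ne', one_mul]

theorem measurableSet_cube (N : ℕ) (p : Fin d → ℝ) (k : Fin d → ℕ) :
    MeasurableSet (cube N p k) :=
  (isCompact_cube N p k).isClosed.measurableSet

/-- Distinct cubes meet at most in a hyperplane. -/
theorem volume_cube_inter {N : ℕ} (hN : 1 ≤ N) (p : Fin d → ℝ) {k l : Fin d → ℕ} (hkl : k ≠ l) :
    volume (cube N p k ∩ cube N p l) = 0 := by
  have hs := mesh_pos hN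
  have key : ∀ {a b : Fin d → ℕ} {i : Fin d}, a i < b i →
      volume (cube N p a ∩ cube N p b) = 0 := by
    intro a b i hab
    refine measure_mono_null (fun y hy => ?_) (Measure.pi_hyperplane (fun _ : Fin d => volume) i
      (((a i : ℝ) + 1 / 2 - N * p i) * mesh N))
    have h1 := (hy.1 i (Set.mem_univ i)).2
    have h2 := (hy.2 i (Set.mem_univ i)).1
    simp only [delta_eq] at h1 h2
    have h3 : (a i : ℝ) + 1 ≤ b i := by exact_mod_cast hab
    refine le_antisymm h1 (le_trans ?_ h2)
    exact mul_le_mul_of_nonneg_right (by linarith) hs.le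
  obtain ⟨i, hi⟩ := Function.ne_iff.1 hkl
  rcases hi.lt_or_gt with h | h
  · exact key h
  · rw [Set.inter_comm]; exact key h

theorem setIntegral_cubeUnion {N : ℕ} (hN : 1 ≤ N) (p : Fin d → ℝ) (A : Set (Fin d → ℕ))
    {F : (Fin d → ℝ) → ℝ} (hF : Continuous F) :
    ∫ y in cubeUnion N p A, F y = ∑ k ∈ latticePoints N A, ∫ y in cube N p k, F y := by
  have e : cubeUnion N p A = ⋃ k : latticePoints N A, cube N p k := by
    rw [cubeUnion, Set.iUnion_subtype]
  have hint := integrableOn_of_continuous (isCompact_cubeUnion N p A) hF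
  rw [e] at hint ⊢
  rw [integral_iUnion_ae (s := fun k : latticePoints N A => cube N p k)
    (fun k => (measurableSet_cube N p k).nullMeasurableSet)
    (fun k l hkl => volume_cube_inter hN p (Subtype.coe_injective.ne hkl)) hint, tsum_fintype]
  exact Finset.sum_coe_sort (latticePoints N A) fun k => ∫ y in cube N p k, F y

theorem integrable_exp_neg_abs : Integrable fun t : ℝ => Real.exp (-|t|) := by
  rw [← integrableOn_univ, ← Set.Iic_union_Ioi (a := (0 : ℝ))]
  refine IntegrableOn.union ?_ ?_
  · refine (integrableOn_exp_Iic 0).congr_fun (fun t ht => ?_) measurableSet_Iic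
    rw [abs_of_nonpos ht, neg_neg]
  · refine (integrableOn_exp_neg_Ioi 0).congr_fun (fun t ht => ?_) measurableSet_Ioi
    rw [abs_of_pos ht]

theorem integrable_exp_neg_l1Norm : Integrable fun y : Fin d → ℝ => Real.exp (-l1Norm y) := by
  have h := Integrable.fintype_prod (ι := Fin d) (f := fun _ t => Real.exp (-|t|))
    (μ := fun _ => (volume : Measure ℝ)) fun _ => integrable_exp_neg_abs
  refine h.congr (Eventually.of_forall fun y => ?_)
  simp only [l1Norm]
  rw [← Finset.sum_neg_distrib, Real.exp_sum]

theorem continuous_l1Norm : Continuous (l1Norm : (Fin d → ℝ) → ℝ) := by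
  unfold l1Norm
  fun_prop

theorem l1Norm_add_le (x y : Fin d → ℝ) : l1Norm (x + y) ≤ l1Norm x + l1Norm y := by
  simp only [l1Norm, ← Finset.sum_add_distrib]
  exact Finset.sum_le_sum fun i _ => abs_add_le _ _

theorem l1Norm_smul (c : ℝ) (x : Fin d → ℝ) : l1Norm (c • x) = |c| * l1Norm x := by
  simp [l1Norm, abs_mul, Finset.mul_sum]

/-- Riemann sums of `exp (-‖y‖₁)` over the normalized lattice are bounded uniformly in the mesh. -/
theorem sum_exp_neg_l1Norm_le {N : ℕ} (hN : 1 ≤ N) (p : Fin d → ℝ) (A : Set (Fin d → ℕ)) :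
    ∑ k ∈ latticePoints N A, mesh N ^ d * Real.exp (-l1Norm (centre N p k))
      ≤ Real.exp (d / 2) * ∫ y : Fin d → ℝ, Real.exp (-l1Norm y) := by
  have hs := mesh_pos hN
  have hcont : Continuous fun y : Fin d → ℝ => Real.exp (-l1Norm y) :=
    Real.continuous_exp.comp continuous_l1Norm.neg
  have h1 : ∀ k : Fin d → ℕ, mesh N ^ d * Real.exp (-l1Norm (centre N p k))
      ≤ Real.exp (d / 2) * ∫ y in cube N p k, Real.exp (-l1Norm y) := by
    intro k
    rw [setIntegral_cube hN, mul_left_comm, ← integral_const_mul]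
    refine mul_le_mul_of_nonneg_left ?_ (by positivity)
    have hshift : Continuous fun u : Fin d → ℝ =>
        Real.exp (d / 2) * Real.exp (-l1Norm (centre N p k + mesh N • u)) :=
      continuous_const.mul (hcont.comp (by fun_prop))
    have h2 : ∫ _ in unitCube d, Real.exp (-l1Norm (centre N p k))
        = Real.exp (-l1Norm (centre N p k)) := by
      rw [setIntegral_const, measureReal_def, volume_unitCube]
      simp
    rw [← h2]
    refine setIntegral_mono_on (integrableOn_of_continuous isCompact_unitCube continuous_const)
      (integrableOn_of_continuous isCompact_unitCube hshift) measurableSet_unitCube fun u hu => ?_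
    rw [← Real.exp_add]
    refine Real.exp_le_exp.2 ?_
    have h3 := l1Norm_add_le (centre N p k) (mesh N • u)
    rw [l1Norm_smul, abs_of_pos hs] at h3
    have h4 := l1Norm_le_of_mem_unitCube hu
    have h5 : mesh N * l1Norm u ≤ l1Norm u :=
      mul_le_of_le_one_left (l1Norm_nonneg u) (mesh_le_one hN)
    linarith
  calc _ ≤ ∑ k ∈ latticePoints N A, Real.exp (d / 2) * ∫ y in cube N p k, Real.exp (-l1Norm y) :=
        Finset.sum_le_sum fun k _ => h1 k
    _ = Real.exp (d / 2) * ∫ y in cubeUnion N p A, Real.exp (-l1Norm y) := by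
        rw [← Finset.mul_sum, setIntegral_cubeUnion hN p A hcont]
    _ ≤ _ := by
        refine mul_le_mul_of_nonneg_left ?_ (Real.exp_pos _).le
        exact setIntegral_le_integral integrable_exp_neg_l1Norm
          (Eventually.of_forall fun y => (Real.exp_pos _).le)

/-- Riemann sums of the Gaussian density against an exponential weight are bounded. -/
theorem exists_sum_gaussDensity_mul_exp_le {p : Fin d → ℝ}
    (hp : ∀ i, p i ∈ Set.Ioo (0 : ℝ) 1) (hsum : ∑ i, p i < 1) (C : ℝ) :
    ∃ B : ℝ, ∀ (N : ℕ) (_ : 1 ≤ N) (A : Set (Fin d → ℕ)), ∑ k ∈ latticePoints N A,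
      mesh N ^ d * (gaussDensity p (centre N p k) * Real.exp (C * l1Norm (centre N p k))) ≤ B := by
  obtain ⟨C', hC', h⟩ := gaussDensity_mul_exp_le hp hsum C
  refine ⟨C' * (Real.exp (d / 2) * ∫ y : Fin d → ℝ, Real.exp (-l1Norm y)), fun N hN A => ?_⟩
  have hs := mesh_pos hN
  refine le_trans ?_ (mul_le_mul_of_nonneg_left (sum_exp_neg_l1Norm_le hN p A) hC')
  rw [Finset.mul_sum]
  refine Finset.sum_le_sum fun k _ => ?_
  rw [mul_left_comm C']
  exact mul_le_mul_of_nonneg_left (h _) (by positivity)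

theorem integrable_gaussDensity {p : Fin d → ℝ}
    (hp : ∀ i, p i ∈ Set.Ioo (0 : ℝ) 1) (hsum : ∑ i, p i < 1) : Integrable (gaussDensity p) := by
  obtain ⟨C', hC', h⟩ := gaussDensity_mul_exp_le hp hsum 0
  refine (integrable_exp_neg_l1Norm.const_mul C').mono'
    (continuous_gaussDensity p).aestronglyMeasurable (Eventually.of_forall fun y => ?_)
  rw [Real.norm_eq_abs, abs_of_pos (gaussDensity_pos hp hsum y)]
  simpa using h y

/-! ### Exponential moments of the multinomial distribution -/

/-- The occupation numbers of all `d + 1` cells, with `N - ∑ kᵢ` at `none`. -/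
def fullCount (N : ℕ) (k : Fin d → ℕ) : Option (Fin d) → ℕ := fun o => o.elim (N - ∑ i, k i) k

@[simp] theorem fullCount_none (N : ℕ) (k : Fin d → ℕ) : fullCount N k none = N - ∑ i, k i := rfl

@[simp] theorem fullCount_some (N : ℕ) (k : Fin d → ℕ) (i : Fin d) :
    fullCount N k (some i) = k i := rfl

theorem sum_fullCount {N : ℕ} {k : Fin d → ℕ} (hk : ∑ i, k i ≤ N) : ∑ o, fullCount N k o = N := by
  simp only [Fintype.sum_option, fullCount_none, fullCount_some]
  omega

theorem multinomialPMF_eq {N : ℕ} (p : Fin d → ℝ) {k : Fin d → ℕ} (hk : ∑ i, k i ≤ N) :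
    multinomialPMF N p k = (N ! : ℝ) / (∏ o, ((fullCount N k o)! : ℝ)) *
      ∏ o, fullWeight p o ^ fullCount N k o := by
  rw [multinomialPMF, if_pos hk]
  simp only [Fintype.prod_option, fullCount_none, fullCount_some, fullWeight_none, fullWeight_some]
  ring

theorem multinomialPMF_nonneg {p : Fin d → ℝ} (hp : ∀ i, p i ∈ Set.Ioo (0 : ℝ) 1)
    (hsum : ∑ i, p i < 1) (N : ℕ) (k : Fin d → ℕ) : 0 ≤ multinomialPMF N p k := by
  by_cases hk : ∑ i, k i ≤ N
  · rw [multinomialPMF_eq p hk]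
    have := fun o => (fullWeight_pos hp hsum o).le
    exact mul_nonneg (by positivity) (Finset.prod_nonneg fun o _ => pow_nonneg (this o) _)
  · rw [multinomialPMF, if_neg hk]

/-- The probability generating function of the multinomial distribution. -/
theorem sum_multinomialPMF_mul_prod_pow_le {p : Fin d → ℝ} (hp : ∀ i, p i ∈ Set.Ioo (0 : ℝ) 1)
    (hsum : ∑ i, p i < 1) (N : ℕ) (A : Set (Fin d → ℕ)) {z : Option (Fin d) → ℝ}
    (hz : ∀ o, 0 ≤ z o) :
    ∑ k ∈ latticePoints N A, multinomialPMF N p k * ∏ o, z o ^ fullCount N k o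
      ≤ (∑ o, fullWeight p o * z o) ^ N := by
  classical
  rw [Finset.sum_pow_eq_sum_piAntidiag]
  have hinj : Set.InjOn (fullCount (d := d) N) (latticePoints N A) := fun k _ l _ h =>
    funext fun i => congrFun h (some i)
  have hterm : ∀ k ∈ latticePoints N A, multinomialPMF N p k * ∏ o, z o ^ fullCount N k o =
      (Nat.multinomial Finset.univ (fullCount N k) : ℝ) *
        ∏ o, (fullWeight p o * z o) ^ fullCount N k o := by
    intro k hk
    have hkN := (mem_latticePoints.1 hk).2
    have hspec := Nat.multinomial_spec Finset.univ (fullCount N k)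
    rw [sum_fullCount hkN] at hspec
    have hne : (∏ o, ((fullCount N k o)! : ℝ)) ≠ 0 :=
      Finset.prod_ne_zero_iff.2 fun o _ => by positivity
    have hspec' : (∏ o, ((fullCount N k o)! : ℝ)) *
        (Nat.multinomial Finset.univ (fullCount N k) : ℝ) = (N ! : ℝ) := by
      exact_mod_cast hspec
    rw [multinomialPMF_eq p hkN, ← hspec', mul_div_cancel_left₀ _ hne]
    simp only [mul_pow, Finset.prod_mul_distrib]
    ring
  rw [Finset.sum_congr rfl hterm, ← Finset.sum_image (g := fullCount N)
    (f := fun c => (Nat.multinomial Finset.univ c : ℝ) * ∏ o, (fullWeight p o * z o) ^ c o) hinj]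
  refine Finset.sum_le_sum_of_subset_of_nonneg (fun c hc => ?_) fun c _ _ => ?_
  · obtain ⟨k, hk, rfl⟩ := Finset.mem_image.1 hc
    simp [sum_fullCount (mem_latticePoints.1 hk).2]
  · have := fun o => mul_nonneg (fullWeight_pos hp hsum o).le (hz o)
    exact mul_nonneg (Nat.cast_nonneg _) (Finset.prod_nonneg fun o _ => pow_nonneg (this o) _)

theorem centre_apply (N : ℕ) (p : Fin d → ℝ) (k : Fin d → ℕ) (i : Fin d) :
    centre N p k i = (k i - N * p i) * mesh N := rfl

/-- A Chernoff bound: exponential moments of the normalized multinomial vector are bounded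
uniformly in `N`. -/
theorem sum_multinomialPMF_mul_exp_le {p : Fin d → ℝ} (hp : ∀ i, p i ∈ Set.Ioo (0 : ℝ) 1)
    (hsum : ∑ i, p i < 1) {N : ℕ} (hN : 1 ≤ N) (A : Set (Fin d → ℕ)) {v : Fin d → ℝ}
    (hv : ∀ i, |v i| ≤ 1) :
    ∑ k ∈ latticePoints N A, multinomialPMF N p k * Real.exp (∑ i, v i * centre N p k i)
      ≤ Real.exp 1 := by
  have hs := mesh_pos hN
  have hs1 := mesh_le_one hN
  set s := mesh N with hsdef
  set z : Option (Fin d) → ℝ := fun o => o.elim 1 fun i => Real.exp (s * v i) with hz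
  have hz0 : ∀ o, 0 ≤ z o := by
    rintro (_ | i)
    · exact zero_le_one
    · exact (Real.exp_pos _).le
  have hterm : ∀ k, Real.exp (∑ i, v i * centre N p k i) =
      (∏ o, z o ^ fullCount N k o) * Real.exp (-(N * ∑ i, p i * (s * v i))) := by
    intro k
    rw [Fintype.prod_option]
    simp only [hz, Option.elim, one_pow, one_mul, fullCount_some, ← Real.exp_nat_mul]
    rw [← Real.exp_sum, ← Real.exp_add, Finset.mul_sum, ← sub_eq_add_neg,
      ← Finset.sum_sub_distrib]
    congr 1
    refine Finset.sum_congr rfl fun i _ => ?_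
    rw [centre_apply, ← hsdef]
    ring
  simp only [hterm, ← mul_assoc, ← Finset.sum_mul]
  -- `1 + p (eʷ - 1) ≤ exp (p w + p w²)`; the linear parts cancel against the centring
  have hbase : ∑ o, fullWeight p o * z o ≤
      Real.exp (∑ i, p i * (s * v i) + ∑ i, p i * (s * v i) ^ 2) := by
    refine le_trans ?_ (Real.add_one_le_exp _)
    rw [Fintype.sum_option]
    have h1 : ∑ i, p i * Real.exp (s * v i) ≤ ∑ i, (p i * (s * v i) + p i * (s * v i) ^ 2 + p i) := by
      refine Finset.sum_le_sum fun i _ => ?_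
      have habs : |s * v i| ≤ 1 := by
        rw [abs_mul, abs_of_pos hs]
        exact mul_le_one₀ hs1 (abs_nonneg _) (hv i)
      have h2 := (abs_le.1 (Real.abs_exp_sub_one_sub_id_le habs)).2
      have h3 := mul_le_mul_of_nonneg_left h2 (hp i).1.le
      linarith
    simp only [Finset.sum_add_distrib] at h1
    have h4 : fullWeight p none * z none = 1 - ∑ i, p i := by
      simp [hz, qWeight]
    rw [h4]
    simp only [hz, Option.elim, fullWeight_some]
    linarith
  have h5 := (sum_multinomialPMF_mul_prod_pow_le hp hsum N A hz0).trans (pow_le_pow_left₀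
    (Finset.sum_nonneg fun o _ => mul_nonneg (fullWeight_pos hp hsum o).le (hz0 o)) hbase N)
  refine (mul_le_mul_of_nonneg_right h5 (Real.exp_pos _).le).trans ?_
  rw [← Real.exp_nat_mul, ← Real.exp_add]
  refine Real.exp_le_exp.2 ?_
  have h6 : ∑ i, p i * (s * v i) ^ 2 ≤ s ^ 2 * 1 := by
    refine le_trans (Finset.sum_le_sum (g := fun i => s ^ 2 * p i) fun i _ => ?_) ?_
    · have h7 : v i ^ 2 ≤ 1 := (sq_le_one_iff_abs_le_one _).2 (hv i)
      have h8 := mul_le_mul_of_nonneg_left h7 (mul_nonneg (sq_nonneg s) (hp i).1.le)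
      nlinarith
    · rw [← Finset.mul_sum]
      exact mul_le_mul_of_nonneg_left hsum.le (sq_nonneg s)
  have h9 := mul_le_mul_of_nonneg_left h6 (Nat.cast_nonneg (α := ℝ) N)
  rw [mul_one, mul_mesh_sq hN] at h9
  simp only [mul_assoc]
  linarith

theorem sum_multinomialPMF_mul_exp_l1Norm_le {p : Fin d → ℝ}
    (hp : ∀ i, p i ∈ Set.Ioo (0 : ℝ) 1) (hsum : ∑ i, p i < 1) {N : ℕ} (hN : 1 ≤ N)
    (A : Set (Fin d → ℕ)) :
    ∑ k ∈ latticePoints N A, multinomialPMF N p k * Real.exp (l1Norm (centre N p k))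
      ≤ 2 ^ d * Real.exp 1 := by
  -- `exp ‖x‖₁` is one of the `2 ^ d` terms `exp (∑ ± xᵢ)`
  have h1 : ∀ x : Fin d → ℝ, Real.exp (l1Norm x) ≤
      ∑ ε : Fin d → Bool, Real.exp (∑ i, (if ε i then 1 else -1) * x i) := by
    intro x
    have h := Finset.single_le_sum (s := Finset.univ)
      (f := fun ε : Fin d → Bool => Real.exp (∑ i, (if ε i then 1 else -1) * x i))
      (fun _ _ => (Real.exp_pos _).le) (Finset.mem_univ fun i => decide (0 ≤ x i))
    refine le_trans (le_of_eq ?_) h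
    simp only [l1Norm]
    congr 1
    refine Finset.sum_congr rfl fun i _ => ?_
    by_cases hx : 0 ≤ x i
    · simp [hx, abs_of_nonneg]
    · simp [hx, abs_of_neg (not_le.1 hx)]
  calc _ ≤ ∑ k ∈ latticePoints N A, ∑ ε : Fin d → Bool, multinomialPMF N p k *
        Real.exp (∑ i, (if ε i then 1 else -1) * centre N p k i) := by
        refine Finset.sum_le_sum fun k _ => ?_
        rw [← Finset.mul_sum]
        exact mul_le_mul_of_nonneg_left (h1 _) (multinomialPMF_nonneg hp hsum N k)
    _ = ∑ ε : Fin d → Bool, ∑ k ∈ latticePoints N A, multinomialPMF N p k *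
        Real.exp (∑ i, (if ε i then 1 else -1) * centre N p k i) := Finset.sum_comm
    _ ≤ ∑ _ε : Fin d → Bool, Real.exp 1 := by
        refine Finset.sum_le_sum fun ε _ => sum_multinomialPMF_mul_exp_le hp hsum hN A fun i => ?_
        split_ifs <;> simp
    _ = _ := by simp

theorem fullCoord_centre {N : ℕ} (p : Fin d → ℝ) {k : Fin d → ℕ} (hk : ∑ i, k i ≤ N)
    (o : Option (Fin d)) :
    fullCoord (centre N p k) o = (fullCount N k o - N * fullWeight p o) * mesh N := by
  cases o with
  | some i => rfl
  | none =>
    simp only [fullCoord_none, delta_eq, toReal, fullCount_none, fullWeight_none, qWeight]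
    rw [← Finset.sum_mul, Finset.sum_sub_distrib, ← Finset.mul_sum]
    push_cast [hk]
    ring

/-! ### The local expansion in the bulk -/

/-- The range of lattice points where the local expansion is valid: relative deviations of all
cell counts are at most `1/2`, and `‖δ_k‖₁³ ≤ √N`, which keeps the logarithmic correction bounded. -/
def IsBulk (p : Fin d → ℝ) (N : ℕ) (k : Fin d → ℕ) : Prop :=
  mesh N * l1Norm (centre N p k) ^ 3 ≤ 1 ∧
    ∀ o, mesh N * |fullCoord (centre N p k) o| ≤ fullWeight p o / 2

/-- The lattice points in the bulk, for all `N ≥ 1` together. -/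
def BulkParam (p : Fin d → ℝ) : Type :=
  {ω : ℕ × (Fin d → ℕ) // (1 ≤ ω.1 ∧ ∑ i, ω.2 i ≤ ω.1) ∧ IsBulk p ω.1 ω.2}

namespace BulkParam

variable {p : Fin d → ℝ}

/-- The number of trials. -/
def N (ω : BulkParam p) : ℕ := ω.1.1

/-- The lattice point. -/
def k (ω : BulkParam p) : Fin d → ℕ := ω.1.2

/-- The normalized lattice point. -/
def x (ω : BulkParam p) : Fin d → ℝ := centre ω.N p ω.k

/-- The mesh `N^{-1/2}`. -/
def s (ω : BulkParam p) : ℝ := mesh ω.N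

theorem one_le_N (ω : BulkParam p) : 1 ≤ ω.N := ω.2.1.1

theorem s_pos (ω : BulkParam p) : 0 < ω.s := mesh_pos ω.one_le_N

theorem s_le_one (ω : BulkParam p) : ω.s ≤ 1 := mesh_le_one ω.one_le_N

theorem N_mul_s_sq (ω : BulkParam p) : (ω.N : ℝ) * ω.s ^ 2 = 1 := mul_mesh_sq ω.one_le_N

theorem sum_k_le (ω : BulkParam p) : ∑ i, ω.k i ≤ ω.N := ω.2.1.2

/-- The relative deviation of the count of a cell from its mean. -/
def t (ω : BulkParam p) (o : Option (Fin d)) : ℝ := ω.s * fullCoord ω.x o / fullWeight p o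

/-- The contribution of a cell to the logarithm of the ratio of the mass function to
`N^{-d/2} φ(δ_k)`. -/
def cellLogRatio (ω : BulkParam p) (o : Option (Fin d)) : ℝ :=
  -(Real.log (1 + ω.t o) / 2)
    - ω.N * fullWeight p o * ((1 + ω.t o) * Real.log (1 + ω.t o) - (ω.t o + ω.t o ^ 2 / 2))
    - ω.s ^ 2 * (1 + ω.t o)⁻¹ / (12 * fullWeight p o) - stirlingError (fullCount ω.N ω.k o)

/-- The logarithm of the ratio of the mass function to `N^{-d/2} φ(δ_k)`. -/
def logRatio (ω : BulkParam p) : ℝ :=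
  ∑ o, ω.cellLogRatio o + ω.s ^ 2 / 12 + stirlingError ω.N

end BulkParam

open Scale

/-- Orders in `N^{-1/2}` over the bulk, with growth measured by the norm of `δ_k`. -/
def bulkScale (p : Fin d → ℝ) : Scale (BulkParam p) where
  s := BulkParam.s
  size := fun ω => l1Norm ω.x
  s_pos := BulkParam.s_pos
  s_le_one := BulkParam.s_le_one
  size_nonneg := fun _ => l1Norm_nonneg _

variable {p : Fin d → ℝ}

theorem BulkParam.abs_t_le (hp : ∀ i, p i ∈ Set.Ioo (0 : ℝ) 1)
    (hsum : ∑ i, p i < 1) (ω : BulkParam p) (o : Option (Fin d)) : |ω.t o| ≤ 1 / 2 := by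
  have hw := fullWeight_pos hp hsum o
  have h : ω.s * |fullCoord ω.x o| ≤ fullWeight p o / 2 := ω.2.2.2 o
  rw [BulkParam.t, abs_div, abs_mul, abs_of_pos hw, abs_of_pos ω.s_pos, div_le_iff₀ hw]
  linarith

theorem BulkParam.count_eq (hp : ∀ i, p i ∈ Set.Ioo (0 : ℝ) 1)
    (hsum : ∑ i, p i < 1) (ω : BulkParam p) (o : Option (Fin d)) :
    (fullCount ω.N ω.k o : ℝ) = ω.N * fullWeight p o * (1 + ω.t o) := by
  have hw := fullWeight_pos hp hsum o
  have h := fullCoord_centre p ω.sum_k_le o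
  change fullCoord ω.x o = _ * ω.s at h
  have hN := ω.N_mul_s_sq
  rw [BulkParam.t, h]
  field_simp
  linear_combination (-(fullCount ω.N ω.k o : ℝ) + ω.N * fullWeight p o) * hN

theorem BulkParam.count_ge (hp : ∀ i, p i ∈ Set.Ioo (0 : ℝ) 1)
    (hsum : ∑ i, p i < 1) (ω : BulkParam p) (o : Option (Fin d)) :
    ω.N * fullWeight p o / 2 ≤ (fullCount ω.N ω.k o : ℝ) := by
  rw [ω.count_eq hp hsum]
  have hw := fullWeight_pos hp hsum o
  have ht := (abs_le.1 (ω.abs_t_le hp hsum o)).1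
  have : (0 : ℝ) ≤ ω.N * fullWeight p o := by positivity
  nlinarith

theorem BulkParam.count_pos (hp : ∀ i, p i ∈ Set.Ioo (0 : ℝ) 1)
    (hsum : ∑ i, p i < 1) (ω : BulkParam p) (o : Option (Fin d)) :
    (0 : ℝ) < (fullCount ω.N ω.k o : ℝ) := by
  have hw := fullWeight_pos hp hsum o
  have hN : (0 : ℝ) < ω.N := by exact_mod_cast ω.one_le_N
  exact lt_of_lt_of_le (by positivity) (ω.count_ge hp hsum o)

theorem BulkParam.abs_stirlingError_count_le (hp : ∀ i, p i ∈ Set.Ioo (0 : ℝ) 1)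
    (hsum : ∑ i, p i < 1) (ω : BulkParam p) (o : Option (Fin d)) :
    |stirlingError (fullCount ω.N ω.k o)| ≤ 4 / fullWeight p o ^ 2 * ω.s ^ 4 := by
  have hw := fullWeight_pos hp hsum o
  have hN : (0 : ℝ) < ω.N := by exact_mod_cast ω.one_le_N
  have hc := ω.count_pos hp hsum o
  refine (abs_stirlingError_le (by exact_mod_cast hc.ne')).trans ?_
  have h1 : (ω.N * fullWeight p o / 2) ^ 2 ≤ (fullCount ω.N ω.k o : ℝ) ^ 2 :=
    pow_le_pow_left₀ (by positivity) (ω.count_ge hp hsum o) 2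
  have hs : ω.s ^ 4 = 1 / (ω.N : ℝ) ^ 2 := by
    rw [eq_div_iff (by positivity)]
    linear_combination (ω.N * ω.s ^ 2 + 1 : ℝ) * ω.N_mul_s_sq
  calc 1 / (fullCount ω.N ω.k o : ℝ) ^ 2 ≤ 1 / (ω.N * fullWeight p o / 2) ^ 2 :=
        one_div_le_one_div_of_le (by positivity) h1
    _ = _ := by rw [hs]; field_simp; norm_num

/-- The factorization behind the local expansion: entropy terms that are linear in the deviations
cancel because the deviations sum to zero, and the quadratic ones form the Gaussian exponent. -/
theorem BulkParam.multinomialPMF_eq_mul_exp (hp : ∀ i, p i ∈ Set.Ioo (0 : ℝ) 1)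
    (hsum : ∑ i, p i < 1) (ω : BulkParam p) :
    multinomialPMF ω.N p ω.k = ω.s ^ d * gaussDensity p ω.x * Real.exp ω.logRatio := by
  have hN : (0 : ℝ) < ω.N := by exact_mod_cast ω.one_le_N
  have hs := ω.s_pos
  have hNs := ω.N_mul_s_sq
  -- Stirling's formula for a single cell, with the linear and quadratic entropy terms split off
  have hcell : ∀ o, Real.log ((fullCount ω.N ω.k o)! : ℝ)
      - fullCount ω.N ω.k o * Real.log (fullWeight p o)
      = (Real.log (2 * Real.pi) + Real.log ω.N) / 2 + Real.log (fullWeight p o) / 2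
        + fullCount ω.N ω.k o * (Real.log ω.N - 1) + ω.N * ω.s * fullCoord ω.x o
        + fullCoord ω.x o * fullCoord ω.x o / fullWeight p o / 2 - ω.cellLogRatio o := by
    intro o
    have hw := fullWeight_pos hp hsum o
    have hc := ω.count_pos hp hsum o
    have hceq := ω.count_eq hp hsum o
    have ht1 : 0 < 1 + ω.t o := by
      have := (abs_le.1 (ω.abs_t_le hp hsum o)).1
      linarith
    have hlog : Real.log (fullCount ω.N ω.k o) =
        Real.log ω.N + Real.log (fullWeight p o) + Real.log (1 + ω.t o) := by
      rw [hceq, Real.log_mul (by positivity) ht1.ne', Real.log_mul hN.ne' hw.ne']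
    have h1 : 1 / (12 * (fullCount ω.N ω.k o : ℝ)) =
        ω.s ^ 2 * (1 + ω.t o)⁻¹ / (12 * fullWeight p o) := by
      rw [hceq]
      field_simp
      linear_combination -hNs
    have h2 : ω.N * fullWeight p o * (ω.t o + ω.t o ^ 2 / 2) = ω.N * ω.s * fullCoord ω.x o
        + fullCoord ω.x o * fullCoord ω.x o / fullWeight p o / 2 := by
      rw [BulkParam.t]
      field_simp
      linear_combination (fullCoord ω.x o ^ 2) * hNs
    rw [BulkParam.cellLogRatio, stirlingError, Real.log_mul (by positivity) hc.ne', hlog, h1, hceq]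
    linear_combination h2
  have hsumcell := Finset.sum_congr (rfl : (Finset.univ : Finset (Option (Fin d))) = _)
    fun o _ => hcell o
  simp only [Finset.sum_add_distrib, Finset.sum_sub_distrib, ← Finset.mul_sum, ← Finset.sum_mul,
    sum_fullCoord, ← Finset.sum_div] at hsumcell
  have hcount : ∑ o, (fullCount ω.N ω.k o : ℝ) = ω.N := by
    exact_mod_cast sum_fullCount ω.sum_k_le
  rw [hcount] at hsumcell
  have hq : covForm p ω.x ω.x = ∑ o, fullCoord ω.x o * fullCoord ω.x o / fullWeight p o := rfl
  rw [← hq] at hsumcell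
  simp only [Finset.sum_const, Finset.card_univ, Fintype.card_option, Fintype.card_fin,
    nsmul_eq_mul] at hsumcell
  have hfac : Real.log (ω.N ! : ℝ) = (Real.log (2 * Real.pi) + Real.log ω.N) / 2
      + ω.N * Real.log ω.N - ω.N + ω.s ^ 2 / 12 + stirlingError ω.N := by
    have h1 : 1 / (12 * (ω.N : ℝ)) = ω.s ^ 2 / 12 := by
      field_simp
      linear_combination -hNs
    rw [stirlingError, Real.log_mul (by positivity) hN.ne', h1]
    ring
  have hwpos := fullWeight_pos hp hsum
  have hW : ∏ o, fullWeight p o = (∏ i, p i) * qWeight p := by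
    rw [Fintype.prod_option]
    simp [mul_comm]
  have hWpos : 0 < ∏ o, fullWeight p o := Finset.prod_pos fun o _ => hwpos o
  have hlogs : Real.log ω.s = -(Real.log ω.N / 2) := by
    rw [BulkParam.s, mesh, Real.log_inv, Real.log_sqrt hN.le]
  have hpmfpos : 0 < multinomialPMF ω.N p ω.k := by
    rw [multinomialPMF_eq p ω.sum_k_le]
    exact mul_pos (by positivity) (Finset.prod_pos fun o _ => pow_pos (hwpos o) _)
  have hg0 : gaussDensity p 0 = (√((2 * Real.pi) ^ d * ∏ o, fullWeight p o))⁻¹ := by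
    rw [gaussDensity, hW]
    simp [mul_assoc]
  have hgpos := gaussDensity_pos hp hsum
  refine Real.log_injOn_pos hpmfpos
    (mul_pos (mul_pos (pow_pos hs d) (hgpos _)) (Real.exp_pos _)) ?_
  have hlogW : Real.log (∏ o, fullWeight p o) = ∑ o, Real.log (fullWeight p o) :=
    Real.log_prod fun o _ => (hwpos o).ne'
  have hlogF : Real.log (∏ o, ((fullCount ω.N ω.k o)! : ℝ)) =
      ∑ o, Real.log ((fullCount ω.N ω.k o)! : ℝ) :=
    Real.log_prod fun o _ => by positivity
  have hlogP : Real.log (∏ o, fullWeight p o ^ fullCount ω.N ω.k o) =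
      ∑ o, fullCount ω.N ω.k o * Real.log (fullWeight p o) := by
    rw [Real.log_prod fun o _ => (pow_pos (hwpos o) _).ne']
    simp only [Real.log_pow]
  rw [multinomialPMF_eq p ω.sum_k_le, Real.log_mul (by positivity)
      (Finset.prod_pos fun o _ => pow_pos (hwpos o) _).ne', Real.log_div (by positivity)
      (by positivity), hlogF, hlogP, hfac, Real.log_mul (by have := hgpos ω.x; positivity)
      (Real.exp_pos _).ne', Real.log_exp, Real.log_mul (by positivity) (hgpos _).ne',
    Real.log_pow, hlogs, gaussDensity_eq hp hsum ω.x, Real.log_mul (hgpos 0).ne'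
      (Real.exp_pos _).ne', Real.log_exp, hg0, Real.log_inv, Real.log_sqrt (by positivity),
    Real.log_mul (by positivity) hWpos.ne', Real.log_pow, hlogW, BulkParam.logRatio]
  push_cast at hsumcell
  linear_combination -hsumcell

theorem BulkParam.exists_abs_cellLogRatio_le (hp : ∀ i, p i ∈ Set.Ioo (0 : ℝ) 1)
    (hsum : ∑ i, p i < 1) (o : Option (Fin d)) :
    ∃ C, ∀ ω : BulkParam p, |ω.cellLogRatio o| ≤ C := by
  have hw := fullWeight_pos hp hsum o
  set w := fullWeight p o with hwdef
  refine ⟨1 / 2 + 2 / w ^ 2 + 1 / (6 * w) + 4 / w ^ 2, fun ω => ?_⟩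
  have hs := ω.s_pos
  have hs1 := ω.s_le_one
  have ht := ω.abs_t_le hp hsum o
  have h1 : |Real.log (1 + ω.t o) / 2| ≤ 1 / 2 := by
    rw [abs_div, abs_of_pos (by norm_num : (0 : ℝ) < 2)]
    have := abs_log_one_add_le ht
    linarith
  have h2 : |ω.N * w * ((1 + ω.t o) * Real.log (1 + ω.t o) - (ω.t o + ω.t o ^ 2 / 2))|
      ≤ 2 / w ^ 2 := by
    have hNw : (0 : ℝ) ≤ ω.N * w := by positivity
    rw [abs_mul, abs_of_nonneg hNw]
    refine (mul_le_mul_of_nonneg_left (abs_entropy_sub_two_le ht) hNw).trans ?_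
    have e : ω.N * w * (2 * |ω.t o| ^ 3) = 2 * (ω.s * |fullCoord ω.x o| ^ 3) / w ^ 2 := by
      rw [BulkParam.t, ← hwdef, abs_div, abs_mul, abs_of_pos hw, abs_of_pos hs]
      field_simp
      linear_combination |fullCoord ω.x o| ^ 3 * ω.N_mul_s_sq
    rw [e]
    have h3 : ω.s * l1Norm ω.x ^ 3 ≤ 1 := ω.2.2.1
    have h4 : ω.s * |fullCoord ω.x o| ^ 3 ≤ ω.s * l1Norm ω.x ^ 3 := by
      have := abs_fullCoord_le ω.x o
      gcongr
    exact div_le_div_of_nonneg_right (by linarith) (by positivity)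
  have h3 : |ω.s ^ 2 * (1 + ω.t o)⁻¹ / (12 * w)| ≤ 1 / (6 * w) := by
    have ht1 : 1 / 2 ≤ 1 + ω.t o := by
      have := (abs_le.1 ht).1
      linarith
    have ht2 : (1 + ω.t o)⁻¹ ≤ 2 := by
      refine (inv_anti₀ (by norm_num) ht1).trans_eq (by norm_num)
    have ht3 : 0 < (1 + ω.t o)⁻¹ := inv_pos.2 (by linarith)
    rw [abs_of_nonneg (by positivity), div_le_div_iff₀ (by positivity) (by positivity)]
    have h5 : ω.s ^ 2 * (1 + ω.t o)⁻¹ ≤ 1 * 2 := by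
      have := pow_le_one₀ hs.le hs1 (n := 2)
      gcongr
    nlinarith
  have h4 : |stirlingError (fullCount ω.N ω.k o)| ≤ 4 / w ^ 2 := by
    refine (ω.abs_stirlingError_count_le hp hsum o).trans ?_
    exact mul_le_of_le_one_right (by positivity) (pow_le_one₀ hs.le hs1)
  rw [BulkParam.cellLogRatio]
  rw [abs_le] at *
  constructor <;> linarith [h1.1, h1.2, h2.1, h2.2, h3.1, h3.2, h4.1, h4.2]

theorem isO_fullCoord_bulk (o : Option (Fin d)) :
    (bulkScale p).IsO 0 fun ω => fullCoord ω.x o :=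
  isO_of_abs_le_size (c := 1) fun ω => by
    have h := abs_fullCoord_le ω.x o
    change |fullCoord ω.x o| ≤ 1 * (1 + l1Norm ω.x)
    linarith

theorem isO_t (o : Option (Fin d)) : (bulkScale p).IsO 1 fun ω => ω.t o :=
  (isO_s.mul (isO_fullCoord_bulk o)).div_const _

theorem isO_cellLogRatio_sub (hp : ∀ i, p i ∈ Set.Ioo (0 : ℝ) 1) (hsum : ∑ i, p i < 1)
    (o : Option (Fin d)) :
    (bulkScale p).IsO 3 fun ω => ω.cellLogRatio o -
      (ω.s * (fullCoord ω.x o ^ 3 / (6 * fullWeight p o ^ 2)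
          - fullCoord ω.x o / (2 * fullWeight p o))
        + ω.s ^ 2 * (fullCoord ω.x o ^ 2 / (4 * fullWeight p o ^ 2)
          - fullCoord ω.x o ^ 4 / (12 * fullWeight p o ^ 3) - (fullWeight p o)⁻¹ / 12)) := by
  have hw := fullWeight_pos hp hsum o
  set w := fullWeight p o with hwdef
  have hs : (bulkScale p).IsO 1 fun ω => ω.s := isO_s
  have ht := (isO_t (p := p) o).abs
  have hx := (isO_fullCoord_bulk (p := p) o).abs
  have hbound : (bulkScale p).IsO 3 fun ω => |ω.t o| ^ 3
      + 4 / w ^ 4 * (|fullCoord ω.x o| ^ 5 * ω.s ^ 3) + 1 / (6 * w) * (ω.s ^ 2 * |ω.t o|)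
      + 4 / w ^ 2 * ω.s ^ 4 :=
    (((ht.pow 3).add (((hx.pow 5).mul (hs.pow 3)).const_mul _)).add
      (((hs.pow 2).mul ht).const_mul _)).add
        (((hs.pow 4).mono (show 3 ≤ 1 * 4 by norm_num)).const_mul _)
  refine hbound.of_abs_le fun ω => (le_trans ?_ (le_abs_self _))
  have hs0 := ω.s_pos
  have hNs := ω.N_mul_s_sq
  have ht2 := ω.abs_t_le hp hsum o
  have h1 := abs_log_one_add_sub_two_le ht2
  have h2 := abs_entropy_sub_le ht2
  have h3 := abs_inv_one_add_sub_one_le ht2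
  have h4 := ω.abs_stirlingError_count_le hp hsum o
  have hNw : (0 : ℝ) ≤ ω.N * w := by positivity
  have h2' : ω.N * w * |(1 + ω.t o) * Real.log (1 + ω.t o)
      - (ω.t o + ω.t o ^ 2 / 2 - ω.t o ^ 3 / 6 + ω.t o ^ 4 / 12)|
      ≤ 4 / w ^ 4 * (|fullCoord ω.x o| ^ 5 * ω.s ^ 3) := by
    refine (mul_le_mul_of_nonneg_left h2 hNw).trans_eq ?_
    rw [BulkParam.t, ← hwdef, abs_div, abs_mul, abs_of_pos hw, abs_of_pos hs0]
    field_simp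
    linear_combination |fullCoord ω.x o| ^ 5 * hNs
  have h3' : ω.s ^ 2 / (12 * w) * |(1 + ω.t o)⁻¹ - 1| ≤ 1 / (6 * w) * (ω.s ^ 2 * |ω.t o|) := by
    refine (mul_le_mul_of_nonneg_left h3 (by positivity)).trans_eq ?_
    field_simp
    ring
  have e : ω.cellLogRatio o -
      (ω.s * (fullCoord ω.x o ^ 3 / (6 * w ^ 2) - fullCoord ω.x o / (2 * w))
        + ω.s ^ 2 * (fullCoord ω.x o ^ 2 / (4 * w ^ 2)
          - fullCoord ω.x o ^ 4 / (12 * w ^ 3) - w⁻¹ / 12))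
      = -((Real.log (1 + ω.t o) - (ω.t o - ω.t o ^ 2 / 2)) / 2)
        - ω.N * w * ((1 + ω.t o) * Real.log (1 + ω.t o)
          - (ω.t o + ω.t o ^ 2 / 2 - ω.t o ^ 3 / 6 + ω.t o ^ 4 / 12))
        - ω.s ^ 2 / (12 * w) * ((1 + ω.t o)⁻¹ - 1) - stirlingError (fullCount ω.N ω.k o) := by
    have e3 : ω.N * w * ω.t o ^ 3 = ω.s * fullCoord ω.x o ^ 3 / w ^ 2 := by
      rw [BulkParam.t, ← hwdef]
      field_simp
      linear_combination fullCoord ω.x o ^ 3 * hNs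
    have e4 : ω.N * w * ω.t o ^ 4 = ω.s ^ 2 * fullCoord ω.x o ^ 4 / w ^ 3 := by
      rw [BulkParam.t, ← hwdef]
      field_simp
      linear_combination fullCoord ω.x o ^ 4 * hNs
    have e1 : ω.t o = ω.s * fullCoord ω.x o / w := rfl
    rw [BulkParam.cellLogRatio, ← hwdef]
    linear_combination (1 / 6 : ℝ) * e3 - (1 / 12 : ℝ) * e4 - (1 / 2 : ℝ) * e1
      + (1 / 4 : ℝ) * (ω.t o + ω.s * fullCoord ω.x o / w) * e1
  rw [e]
  have h5 : |(Real.log (1 + ω.t o) - (ω.t o - ω.t o ^ 2 / 2)) / 2| ≤ |ω.t o| ^ 3 := by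
    rw [abs_div, abs_of_pos (by norm_num : (0 : ℝ) < 2)]
    linarith
  rw [← abs_of_nonneg hNw, ← abs_mul] at h2'
  rw [← abs_of_nonneg (show 0 ≤ ω.s ^ 2 / (12 * w) by positivity), ← abs_mul] at h3'
  rw [abs_le] at h2' h3' h4 h5 ⊢
  constructor <;> linarith [h2'.1, h2'.2, h3'.1, h3'.2, h4.1, h4.2, h5.1, h5.2]

theorem BulkParam.abs_stirlingError_N_le (ω : BulkParam p) : |stirlingError ω.N| ≤ ω.s ^ 4 := by
  refine (abs_stirlingError_le (by have := ω.one_le_N; omega)).trans_eq ?_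
  have hN : (0 : ℝ) < ω.N := by exact_mod_cast ω.one_le_N
  rw [div_eq_iff (by positivity)]
  linear_combination -(ω.N * ω.s ^ 2 + 1 : ℝ) * ω.N_mul_s_sq

theorem isO_logRatio_sub (hp : ∀ i, p i ∈ Set.Ioo (0 : ℝ) 1) (hsum : ∑ i, p i < 1) :
    (bulkScale p).IsO 3 fun ω => ω.logRatio - (ω.s * corrOne p ω.x + ω.s ^ 2 * logCorrTwo p ω.x) := by
  have hs : (bulkScale p).IsO 1 fun ω => ω.s := isO_s
  have h1 := IsO.sum Finset.univ fun o _ => isO_cellLogRatio_sub hp hsum o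
  have h2 : (bulkScale p).IsO 3 fun ω => stirlingError ω.N :=
    ((hs.pow 4).mono (show 3 ≤ 1 * 4 by norm_num)).of_abs_le fun ω =>
      ω.abs_stirlingError_N_le.trans (le_abs_self _)
  refine (h1.add h2).congr fun ω => ?_
  rw [BulkParam.logRatio, corrOne, logCorrTwo]
  simp only [Finset.sum_sub_distrib, Finset.sum_add_distrib, ← Finset.mul_sum, ← Finset.sum_div]
  ring

theorem exists_abs_logRatio_le (hp : ∀ i, p i ∈ Set.Ioo (0 : ℝ) 1) (hsum : ∑ i, p i < 1) :
    ∃ C, ∀ ω : BulkParam p, |ω.logRatio| ≤ C := by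
  choose C hC using BulkParam.exists_abs_cellLogRatio_le hp hsum
  refine ⟨∑ o, C o + 1 / 12 + 1, fun ω => ?_⟩
  have h1 : |∑ o, ω.cellLogRatio o| ≤ ∑ o, C o :=
    (Finset.abs_sum_le_sum_abs _ _).trans (Finset.sum_le_sum fun o _ => hC o ω)
  have h2 := ω.abs_stirlingError_N_le
  have h3 := pow_le_one₀ ω.s_pos.le ω.s_le_one (n := 4)
  have h4 := pow_le_one₀ ω.s_pos.le ω.s_le_one (n := 2)
  have h5 := pow_pos ω.s_pos 2
  rw [BulkParam.logRatio]
  rw [abs_le] at *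
  constructor <;> linarith [h1.1, h1.2, h2.1, h2.2]

/-- The local limit theorem with two correction terms, in the bulk. -/
theorem isO_exp_logRatio_sub (hp : ∀ i, p i ∈ Set.Ioo (0 : ℝ) 1) (hsum : ∑ i, p i < 1) :
    (bulkScale p).IsO 3 fun ω => Real.exp ω.logRatio -
      (1 + ω.s * corrOne p ω.x + ω.s ^ 2 * corrTwo p ω.x) := by
  obtain ⟨C, hC⟩ := exists_abs_logRatio_le hp hsum
  have hs : (bulkScale p).IsO 1 fun ω => ω.s := isO_s
  have hP := isO_corrOne p (isO_fullCoord_bulk (p := p))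
  have hT := isO_logCorrTwo p (isO_fullCoord_bulk (p := p))
  have hρ := isO_logRatio_sub hp hsum
  have hsP := hs.mul hP
  have hsT := (hs.pow 2).mul hT
  have hE : (bulkScale p).IsO 1 fun ω => ω.logRatio :=
    ((hρ.mono (show 1 ≤ 3 by norm_num)).add (hsP.add (hsT.mono one_le_two))).congr
      fun ω => by ring
  have hexp := hE.exp_taylor (c := |C|) fun ω => by
    have := l1Norm_nonneg ω.x
    have h1 := (hC ω).trans (le_abs_self C)
    have h2 := abs_nonneg C
    change _ ≤ |C| * (1 + l1Norm ω.x)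
    nlinarith
  -- the square of the logarithm is that of its leading term up to `O(s³)`
  have hsq := (((hρ.mono (show 2 ≤ 3 by norm_num)).add hsT).mul (hE.add hsP)).div_const 2
  refine ((hexp.add hρ).add hsq).congr fun ω => ?_
  rw [corrTwo]
  ring

/-! ### Summation over the lattice -/

/-- Outside the bulk the exponential weight compensates three powers of the mesh. -/
theorem exists_one_le_of_not_isBulk {p : Fin d → ℝ} (hp : ∀ i, p i ∈ Set.Ioo (0 : ℝ) 1)
    (hsum : ∑ i, p i < 1) :
    ∃ M : ℝ, 0 ≤ M ∧ ∀ (N : ℕ) (k : Fin d → ℕ), 1 ≤ N → ¬ IsBulk p N k →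
      1 ≤ M * mesh N ^ 3 * Real.exp (l1Norm (centre N p k)) := by
  have hw := fullWeight_pos hp hsum
  have hterm : ∀ o, 0 ≤ (2 / fullWeight p o) ^ 3 * (3 ! : ℝ) := fun o => by
    have := hw o
    positivity
  refine ⟨(9 ! : ℝ) + ∑ o, (2 / fullWeight p o) ^ 3 * (3 ! : ℝ),
    add_nonneg (by positivity) (Finset.sum_nonneg fun o _ => hterm o), fun N k hN hk => ?_⟩
  have hs := mesh_pos hN
  set l := l1Norm (centre N p k) with hl
  have hl0 : 0 ≤ l := l1Norm_nonneg _
  have hpow : ∀ n : ℕ, l ^ n ≤ (n ! : ℝ) * Real.exp l := fun n => by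
    have := Real.pow_div_factorial_le_exp l hl0 n
    rwa [div_le_iff₀ (by positivity), mul_comm] at this
  rw [IsBulk, not_and_or] at hk
  rcases hk with h | h
  -- in both cases a power of `l` compensates `mesh N ^ 3`, namely `l ^ 9` and `l ^ 3`
  · have h1 : 1 ≤ (mesh N * l ^ 3) ^ 3 := one_le_pow₀ (not_le.1 h).le
    have h2 := mul_le_mul_of_nonneg_left (hpow 9) (pow_pos hs 3).le
    have h3 : 0 ≤ (∑ o, (2 / fullWeight p o) ^ 3 * (3 ! : ℝ)) * mesh N ^ 3 * Real.exp l :=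
      mul_nonneg (mul_nonneg (Finset.sum_nonneg fun o _ => hterm o) (by positivity)) (by positivity)
    calc 1 ≤ (mesh N * l ^ 3) ^ 3 := h1
      _ = mesh N ^ 3 * l ^ 9 := by ring
      _ ≤ _ := h2
      _ ≤ _ := by rw [add_mul, add_mul]; linarith
  · push Not at h
    obtain ⟨o, ho⟩ := h
    have hwo := hw o
    have h1 : 1 ≤ 2 / fullWeight p o * (mesh N * l) := by
      rw [div_mul_eq_mul_div, le_div_iff₀ hwo]
      have h2 := mul_le_mul_of_nonneg_left (abs_fullCoord_le (centre N p k) o) hs.le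
      rw [← hl] at h2
      linarith
    have h2 := mul_le_mul_of_nonneg_left (hpow 3) (pow_pos hs 3).le
    have h3 : (2 / fullWeight p o) ^ 3 * (3 ! : ℝ) ≤
        ∑ o, (2 / fullWeight p o) ^ 3 * (3 ! : ℝ) :=
      Finset.single_le_sum (f := fun o => (2 / fullWeight p o) ^ 3 * (3 ! : ℝ))
        (fun o _ => hterm o) (Finset.mem_univ o)
    calc 1 ≤ (2 / fullWeight p o * (mesh N * l)) ^ 3 := one_le_pow₀ h1
      _ = (2 / fullWeight p o) ^ 3 * (mesh N ^ 3 * l ^ 3) := by ring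
      _ ≤ (2 / fullWeight p o) ^ 3 * (mesh N ^ 3 * ((3 ! : ℝ) * Real.exp l)) := by gcongr
      _ = ((2 / fullWeight p o) ^ 3 * (3 ! : ℝ)) * mesh N ^ 3 * Real.exp l := by ring
      _ ≤ _ := by
        have h4 : (0 : ℝ) ≤ (9 ! : ℝ) := by positivity
        gcongr
        linarith

/-- The contribution of the cube around `k` to the two-term expansion. -/
def cubeApprox (N : ℕ) (p : Fin d → ℝ) (k : Fin d → ℕ) : ℝ :=
  mesh N ^ d * ∫ u in unitCube d, (1 + mesh N * innerCorr p (mesh N) (centre N p k) u) *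
    gaussDensity p (centre N p k + mesh N • u)

/-- The contribution of the cube around `k` to the two correction terms, divided by the mesh. -/
def cubeCorr (N : ℕ) (p : Fin d → ℝ) (k : Fin d → ℕ) : ℝ :=
  mesh N ^ d * ∫ u in unitCube d, innerCorr p (mesh N) (centre N p k) u *
    gaussDensity p (centre N p k + mesh N • u)

theorem firstCorrection_add_secondCorrection {N : ℕ} (hN : 1 ≤ N) (p : Fin d → ℝ)
    (A : Set (Fin d → ℕ)) :
    firstCorrection N p A + mesh N * secondCorrection N p A
      = ∑ k ∈ latticePoints N A, cubeCorr N p k := by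
  have hg := continuous_gaussDensity p
  have h1 := continuous_corrOne p
  have h2 := continuous_corrTwo p
  rw [firstCorrection_eq, secondCorrection_eq, setIntegral_cubeUnion hN p A (by fun_prop),
    setIntegral_cubeUnion hN p A (by fun_prop), Finset.mul_sum, ← Finset.sum_add_distrib,
    Finset.mul_sum, ← Finset.sum_add_distrib]
  refine Finset.sum_congr rfl fun k _ => ?_
  rw [← integral_const_mul, add_setIntegral (isCompact_cube N p k) (by fun_prop) (by fun_prop),
    ← integral_const_mul, add_setIntegral (isCompact_cube N p k) (by fun_prop) (by fun_prop),
    setIntegral_cube hN, cubeCorr]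
  congr 1
  refine integral_congr_ae (Eventually.of_forall fun u => ?_)
  simp only [innerCorr]
  ring

theorem expansion_eq_sum {N : ℕ} (hN : 1 ≤ N) (p : Fin d → ℝ) (A : Set (Fin d → ℕ)) :
    (∫ y in cubeUnion N p A, gaussDensity p y) + mesh N * firstCorrection N p A
      + (N : ℝ)⁻¹ * secondCorrection N p A = ∑ k ∈ latticePoints N A, cubeApprox N p k := by
  have hg := continuous_gaussDensity p
  have e : mesh N * firstCorrection N p A + (N : ℝ)⁻¹ * secondCorrection N p A
      = mesh N * ∑ k ∈ latticePoints N A, cubeCorr N p k := by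
    rw [← firstCorrection_add_secondCorrection hN, ← mesh_sq]
    ring
  rw [add_assoc, e, setIntegral_cubeUnion hN p A hg, Finset.mul_sum, ← Finset.sum_add_distrib]
  refine Finset.sum_congr rfl fun k _ => ?_
  have hin := continuous_innerCorr p (mesh N) (centre N p k)
  rw [setIntegral_cube hN, cubeCorr, cubeApprox, mul_left_comm, ← mul_add, ← integral_const_mul,
    add_setIntegral isCompact_unitCube (by fun_prop) (by fun_prop)]
  congr 1
  refine integral_congr_ae (Eventually.of_forall fun u => ?_)
  ring

/-- The local error at a single lattice point. The second weight is only needed outside the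
bulk. -/
theorem exists_abs_multinomialPMF_sub_cubeApprox_le {p : Fin d → ℝ}
    (hp : ∀ i, p i ∈ Set.Ioo (0 : ℝ) 1) (hsum : ∑ i, p i < 1) :
    ∃ C : ℝ, 0 ≤ C ∧ ∀ (N : ℕ) (k : Fin d → ℕ), 1 ≤ N → ∑ i, k i ≤ N →
      |multinomialPMF N p k - cubeApprox N p k| ≤ C * mesh N ^ 3 *
        (mesh N ^ d * (gaussDensity p (centre N p k) * Real.exp (C * l1Norm (centre N p k)))
          + multinomialPMF N p k * Real.exp (l1Norm (centre N p k))) := by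
  obtain ⟨C₁, hC₁, h₁⟩ := isO_exp_logRatio_sub hp hsum
  obtain ⟨C₂, hC₂, h₂⟩ := exists_midpoint_bound hp hsum
  obtain ⟨C₃, hC₃, h₃⟩ := exists_cube_integral_bound hp hsum
    (F := fun s x u => 1 + s * innerCorr p s x u)
    ((Scale.isO_const 1).add ((Scale.isO_s.mul (isO_innerCorr hp hsum)).mono zero_le_one))
  obtain ⟨M, hM, h₄⟩ := exists_one_le_of_not_isBulk hp hsum
  refine ⟨C₁ + C₂ + M * C₃ + M + C₃ + 1, by positivity, fun N k hN hk => ?_⟩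
  set C := C₁ + C₂ + M * C₃ + M + C₃ + 1 with hC
  have hMC : 0 ≤ M * C₃ := by positivity
  have hs := mesh_pos hN
  have hs1 := mesh_le_one hN
  have hP := multinomialPMF_nonneg hp hsum N k
  have hg := gaussDensity_pos hp hsum (centre N p k)
  have hl := l1Norm_nonneg (centre N p k)
  set s := mesh N with hsdef
  set x := centre N p k with hx
  by_cases hbulk : IsBulk p N k
  · have hb₁ : |Real.exp (BulkParam.logRatio (p := p) ⟨(N, k), ⟨hN, hk⟩, hbulk⟩) -
        (1 + s * corrOne p x + s ^ 2 * corrTwo p x)| ≤ C₁ * s ^ 3 * Real.exp (C₁ * l1Norm x) :=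
      h₁ ⟨(N, k), ⟨hN, hk⟩, hbulk⟩
    have he : multinomialPMF N p k = s ^ d * gaussDensity p x *
        Real.exp (BulkParam.logRatio (p := p) ⟨(N, k), ⟨hN, hk⟩, hbulk⟩) :=
      BulkParam.multinomialPMF_eq_mul_exp hp hsum ⟨(N, k), ⟨hN, hk⟩, hbulk⟩
    have hb₂ := h₂ s x hs hs1
    set I := ∫ u in unitCube d, (1 + s * innerCorr p s x u) * gaussDensity p (x + s • u)
    set t := 1 + s * corrOne p x + s ^ 2 * corrTwo p x
    set E := Real.exp (BulkParam.logRatio (p := p) ⟨(N, k), ⟨hN, hk⟩, hbulk⟩)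
    have hsplit : multinomialPMF N p k - cubeApprox N p k =
        s ^ d * gaussDensity p x * (E - t) - s ^ d * (I - gaussDensity p x * t) := by
      rw [he]
      change _ - s ^ d * I = _
      ring
    have hexp : ∀ c, c ≤ C → Real.exp (c * l1Norm x) ≤ Real.exp (C * l1Norm x) := fun c hc =>
      Real.exp_le_exp.2 (mul_le_mul_of_nonneg_right hc hl)
    have hw : 0 < s ^ d * gaussDensity p x := by positivity
    calc |multinomialPMF N p k - cubeApprox N p k|
        ≤ s ^ d * gaussDensity p x * |E - t| + s ^ d * |I - gaussDensity p x * t| := by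
          rw [hsplit]
          refine (abs_sub _ _).trans_eq ?_
          rw [abs_mul (s ^ d * gaussDensity p x), abs_mul (s ^ d) (I - _), abs_of_pos hw,
            abs_of_pos (pow_pos hs d)]
      _ ≤ s ^ d * gaussDensity p x * (C₁ * s ^ 3 * Real.exp (C₁ * l1Norm x))
          + s ^ d * (C₂ * s ^ 3 * (gaussDensity p x * Real.exp (C₂ * l1Norm x))) := by
          gcongr
      _ ≤ s ^ d * gaussDensity p x * (C₁ * s ^ 3 * Real.exp (C * l1Norm x))
          + s ^ d * (C₂ * s ^ 3 * (gaussDensity p x * Real.exp (C * l1Norm x))) := by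
          have e1 := hexp C₁ (by linarith)
          have e2 := hexp C₂ (by linarith)
          gcongr
      _ = (C₁ + C₂) * s ^ 3 * (s ^ d * (gaussDensity p x * Real.exp (C * l1Norm x))) := by ring
      _ ≤ C * s ^ 3 * (s ^ d * (gaussDensity p x * Real.exp (C * l1Norm x))
          + multinomialPMF N p k * Real.exp (l1Norm x)) := by
          gcongr
          · linarith
          · exact le_add_of_nonneg_right (by positivity)
  · have hone := h₄ N k hN hbulk
    rw [← hx, ← hsdef] at hone
    have hb₃ : |cubeApprox N p k| ≤
        s ^ d * (C₃ * (gaussDensity p x * Real.exp (C₃ * l1Norm x))) := by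
      change |s ^ d * _| ≤ _
      rw [abs_mul, abs_of_pos (pow_pos hs d)]
      exact mul_le_mul_of_nonneg_left (h₃ s x hs hs1) (by positivity)
    have hexp : Real.exp (l1Norm x) * Real.exp (C₃ * l1Norm x) ≤ Real.exp (C * l1Norm x) := by
      rw [← Real.exp_add]
      refine Real.exp_le_exp.2 ?_
      have : (1 + C₃) * l1Norm x ≤ C * l1Norm x :=
        mul_le_mul_of_nonneg_right (by linarith) hl
      linarith
    calc |multinomialPMF N p k - cubeApprox N p k|
        ≤ multinomialPMF N p k + s ^ d * (C₃ * (gaussDensity p x * Real.exp (C₃ * l1Norm x))) := by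
          refine (abs_sub _ _).trans ?_
          rw [abs_of_nonneg hP]
          gcongr
      _ ≤ (M * s ^ 3 * Real.exp (l1Norm x)) * (multinomialPMF N p k
          + s ^ d * (C₃ * (gaussDensity p x * Real.exp (C₃ * l1Norm x)))) :=
          le_mul_of_one_le_left (by positivity) hone
      _ = M * s ^ 3 * (multinomialPMF N p k * Real.exp (l1Norm x))
          + M * C₃ * s ^ 3 * (s ^ d * (gaussDensity p x *
            (Real.exp (l1Norm x) * Real.exp (C₃ * l1Norm x)))) := by ring
      _ ≤ C * s ^ 3 * (multinomialPMF N p k * Real.exp (l1Norm x))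
          + C * s ^ 3 * (s ^ d * (gaussDensity p x * Real.exp (C * l1Norm x))) := by
          have e1 : M ≤ C := by linarith
          have e2 : M * C₃ ≤ C := by linarith
          gcongr
      _ = _ := by ring

/-- The expansion, with all lattice sums bounded absolutely and hence uniformly in `A`. -/
theorem exists_expansion_bound {p : Fin d → ℝ}
    (hp : ∀ i, p i ∈ Set.Ioo (0 : ℝ) 1) (hsum : ∑ i, p i < 1) :
    ∃ C : ℝ, ∀ N : ℕ, 1 ≤ N → ∀ A : Set (Fin d → ℕ),
      |(∑ k ∈ latticePoints N A, multinomialPMF N p k)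
          - ((∫ y in cubeUnion N p A, gaussDensity p y) + mesh N * firstCorrection N p A
            + (N : ℝ)⁻¹ * secondCorrection N p A)| ≤ C * mesh N ^ 3 := by
  obtain ⟨C, hC, h⟩ := exists_abs_multinomialPMF_sub_cubeApprox_le hp hsum
  obtain ⟨B, hB⟩ := exists_sum_gaussDensity_mul_exp_le hp hsum C
  refine ⟨C * (B + 2 ^ d * Real.exp 1), fun N hN A => ?_⟩
  have hs := mesh_pos hN
  rw [expansion_eq_sum hN, ← Finset.sum_sub_distrib]
  refine (Finset.abs_sum_le_sum_abs _ _).trans ?_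
  refine (Finset.sum_le_sum fun k hk => h N k hN (mem_latticePoints.1 hk).2).trans ?_
  rw [← Finset.mul_sum, Finset.sum_add_distrib]
  have h1 := add_le_add (hB N hN A) (sum_multinomialPMF_mul_exp_l1Norm_le hp hsum hN A)
  calc _ ≤ C * mesh N ^ 3 * (B + 2 ^ d * Real.exp 1) :=
        mul_le_mul_of_nonneg_left h1 (by positivity)
    _ = _ := by ring

/-- The correction terms are bounded uniformly in `N` and `A`. -/
theorem exists_corrections_bound {p : Fin d → ℝ}
    (hp : ∀ i, p i ∈ Set.Ioo (0 : ℝ) 1) (hsum : ∑ i, p i < 1) :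
    ∃ C : ℝ, ∀ N : ℕ, 1 ≤ N → ∀ A : Set (Fin d → ℕ),
      |firstCorrection N p A + mesh N * secondCorrection N p A| ≤ C := by
  obtain ⟨C, hC, h⟩ := exists_cube_integral_bound hp hsum (F := innerCorr p)
    (isO_innerCorr hp hsum)
  obtain ⟨B, hB⟩ := exists_sum_gaussDensity_mul_exp_le hp hsum C
  refine ⟨C * B, fun N hN A => ?_⟩
  have hs := mesh_pos hN
  rw [firstCorrection_add_secondCorrection hN]
  refine (Finset.abs_sum_le_sum_abs _ _).trans ?_
  refine le_trans ?_ (mul_le_mul_of_nonneg_left (hB N hN A) hC)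
  rw [Finset.mul_sum]
  refine Finset.sum_le_sum fun k _ => ?_
  rw [cubeCorr, abs_mul, abs_of_pos (pow_pos hs d), mul_left_comm C]
  exact mul_le_mul_of_nonneg_left (h _ _ hs (mesh_le_one hN)) (by positivity)

theorem nullMeasurableSet_image_delta {N : ℕ} (hN : 1 ≤ N) (p : Fin d → ℝ) {B : Set (Fin d → ℝ)}
    (hB : NullMeasurableSet B volume) : NullMeasurableSet (delta N p '' B) volume := by
  have hs := mesh_pos hN
  set g : (Fin d → ℝ) → Fin d → ℝ := fun y => (fun i => N * p i) + (mesh N)⁻¹ • y with hg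
  have himage : delta N p '' B = g ⁻¹' B := by
    refine Set.image_eq_preimage_of_inverse (fun x => ?_) (fun y => ?_) |> congrFun <| B
    · ext i
      simp only [hg, Pi.add_apply, Pi.smul_apply, smul_eq_mul, delta_eq]
      field_simp
      ring
    · ext i
      simp only [hg, Pi.add_apply, Pi.smul_apply, smul_eq_mul, delta_eq]
      field_simp
      ring
  have hsmul : Measure.QuasiMeasurePreserving (fun y : Fin d → ℝ => (mesh N)⁻¹ • y)
      volume volume := by
    refine ⟨by fun_prop, ?_⟩
    rw [Measure.map_addHaar_smul _ (inv_pos.2 hs).ne']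
    exact Measure.smul_absolutelyContinuous
  have hquasi : Measure.QuasiMeasurePreserving g volume volume :=
    (measurePreserving_add_left volume _).quasiMeasurePreserving.comp hsmul
  rw [himage]
  exact hB.preimage hquasi

theorem abs_setIntegral_sub_le_symmDiff {f : (Fin d → ℝ) → ℝ} (hf : Integrable f)
    (hf0 : ∀ y, 0 ≤ f y) {S T : Set (Fin d → ℝ)} (hS : NullMeasurableSet S volume)
    (hT : NullMeasurableSet T volume) :
    |(∫ y in T, f y) - ∫ y in S, f y| ≤ ∫ y in symmDiff S T, f y := by
  have h1 := integral_inter_add_sdiff₀ (s := T) hS hf.integrableOn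
  have h2 := integral_inter_add_sdiff₀ (s := S) hT hf.integrableOn
  rw [Set.inter_comm] at h2
  have h3 : ∫ y in symmDiff S T, f y = (∫ y in S \ T, f y) + ∫ y in T \ S, f y :=
    setIntegral_union₀ disjoint_sdiff_sdiff.aedisjoint (hT.diff hS) hf.integrableOn hf.integrableOn
  have h4 : 0 ≤ ∫ y in S \ T, f y := integral_nonneg hf0
  have h5 : 0 ≤ ∫ y in T \ S, f y := integral_nonneg hf0
  rw [h3, abs_le]
  constructor <;> linarith

end MultinomialLLT

end

theorem corollary1 {d : ℕ} (p : Fin d → ℝ)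
    (hp : ∀ i, p i ∈ Set.Ioo (0 : ℝ) 1) (hsum : ∑ i, p i < 1) :
    (∃ C : ℝ, ∀ᶠ N : ℕ in atTop, ∀ A : Set (Fin d → ℕ),
      |(∑ k ∈ MultinomialLLT.latticePoints N A, MultinomialLLT.multinomialPMF N p k)
          - ((∫ y in MultinomialLLT.cubeUnion N p A, MultinomialLLT.gaussDensity p y)
            + (N : ℝ) ^ (-(1 / 2) : ℝ) * MultinomialLLT.firstCorrection N p A
            + (N : ℝ)⁻¹ * MultinomialLLT.secondCorrection N p A)|
        ≤ C * (N : ℝ) ^ (-(3 / 2) : ℝ)) ∧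
    (∀ K : ℝ, ∃ C : ℝ, ∀ᶠ N : ℕ in atTop, ∀ B : Set (Fin d → ℝ), NullMeasurableSet B volume →
      (∫ y in symmDiff (MultinomialLLT.delta N p '' B)
          (MultinomialLLT.cubeUnion N p {k | MultinomialLLT.toReal k ∈ B}),
        MultinomialLLT.gaussDensity p y) ≤ K * (N : ℝ) ^ (-(1 / 2) : ℝ) →
      |(∑ k ∈ MultinomialLLT.latticePoints N {k | MultinomialLLT.toReal k ∈ B},
            MultinomialLLT.multinomialPMF N p k)
          - (∫ y in MultinomialLLT.delta N p '' B, MultinomialLLT.gaussDensity p y)|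
        ≤ C * (N : ℝ) ^ (-(1 / 2) : ℝ)) := by
  open MultinomialLLT in
  obtain ⟨C₁, h₁⟩ := exists_expansion_bound hp hsum
  simp only [rpow_neg_half, rpow_neg_three_half]
  refine ⟨⟨C₁, eventually_atTop.2 ⟨1, h₁⟩⟩, fun K => ?_⟩
  obtain ⟨C₂, h₂⟩ := exists_corrections_bound hp hsum
  refine ⟨|C₁| + C₂ + K, eventually_atTop.2 ⟨1, fun N hN B hB hK => ?_⟩⟩
  have hs := mesh_pos hN
  have hs1 := mesh_le_one hN
  set A : Set (Fin d → ℕ) := {k | toReal k ∈ B}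
  have hH : NullMeasurableSet (cubeUnion N p A) volume :=
    (isCompact_cubeUnion N p A).isClosed.measurableSet.nullMeasurableSet
  have hD := abs_setIntegral_sub_le_symmDiff (integrable_gaussDensity hp hsum)
    (fun y => (gaussDensity_pos hp hsum y).le) (nullMeasurableSet_image_delta hN p hB) hH
  have hE := h₁ N hN A
  have hcorr : |mesh N * firstCorrection N p A + (N : ℝ)⁻¹ * secondCorrection N p A|
      ≤ C₂ * mesh N := by
    have e : mesh N * firstCorrection N p A + (N : ℝ)⁻¹ * secondCorrection N p A
        = mesh N * (firstCorrection N p A + mesh N * secondCorrection N p A) := by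
      rw [← mesh_sq]
      ring
    rw [e, abs_mul, abs_of_pos hs, mul_comm]
    exact mul_le_mul_of_nonneg_right (h₂ N hN A) hs.le
  have hcube : C₁ * mesh N ^ 3 ≤ |C₁| * mesh N := by
    have h3 : mesh N ^ 3 ≤ mesh N := pow_le_of_le_one hs.le hs1 (by norm_num)
    exact mul_le_mul (le_abs_self C₁) h3 (by positivity) (abs_nonneg C₁)
  have hD' := abs_le.1 (hD.trans hK)
  have hE' := abs_le.1 (hE.trans hcube)
  have hC' := abs_le.1 hcorr
  rw [abs_le]
  constructor <;> linarith [hD'.1, hD'.2, hE'.1, hE'.2, hC'.1, hC'.2]
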